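/- Let $q=2$. Let $\mathbb{C}_\infty$ be the completion of an algebraic closure of $\mathbb{F}_2((1/\theta))$, with the valuation $\mathrm{ord}$ normalized by $\mathrm{ord}\,\theta=-1$ (and $\mathrm{ord}\,0=+\infty$). Let $\mathbb{C}_\infty[T,\tau]$ be the Anderson ring, i.e. the ring of non-commutative polynomials over $\mathbb{C}_\infty$ with $Ta=aT$, $T\tau=\tau T$, $\tau a=a^{2}\tau$ for $a\in\mathbb{C}_\infty$. For $A\in M_{2\times2}(\mathbb{C}_\infty)$ let $M(A)$ be the left $\mathbb{C}_\infty[T,\tau]$-module that is free over $\mathbb{C}_\infty\{\tau\}$ with basis $e_*=(e_1,e_2)^t$ and on which $T$ acts by $$Te_*=\theta e_*+A\tau e_*+\tau^2e_* .$$ Let $\mathbb{C}_\infty\{T\}$ be the ring of power series $\sum_{i\ge 0} c_iT^i$ over $\mathbb{C}_\infty$ with $c_i\to0$, on which $\tau$ acts by $\sum c_iT^i\mapsto\sum c_i^{2}T^i$. Put $M\{T\}=M\otimes_{\mathbb{C}_\infty[T]}\mathbb{C}_\infty\{T\}$ with $\tau(\alpha\otimes\beta)=\tau\alpha\otimes\tau\beta$,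 let $H^1(M)=M\{T\}^\tau$ be the $\mathbb{F}_2[T]$-module of $\tau$-stable elements, and let $h^1(M)$ be its rank over $\mathbb{F}_2[T]$. Let $A=\begin{pmatrix}a_{11}&a_{12}\\a_{21}&0\end{pmatrix}$ with $a_{11},a_{12},a_{21}\in\mathbb{C}_\infty$, $\mathrm{ord}\,a_{11}=-1$ and $a_{21}\neq0$, and put $u=\mathrm{ord}\,a_{12}\in\mathbb{R}\cup\{+\infty\}$, $v=\mathrm{ord}\,a_{21}\in\mathbb{R}$. Suppose that $(u,v)$ lies in the domain $D_{13}$, i.e. $v>-\tfrac23$ and $u>-2v-2$ (the open domain of the $(u,v)$-plane between the ray $v=-\tfrac23,\ u\ge-\tfrac23$ and the ray $v=-\tfrac12u-1,\ u\le-\tfrac23$, with $u=+\infty$ allowed). Then $$h^1(M(A))=4 .$$ -/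

import Mathlib

noncomputable section

open Polynomial
open scoped NNReal TensorProduct

namespace AndersonMotive

/-! ### The field `ℂ_∞` -/

section ComplexNumbers

variable (k : Type) [Field k] [Fintype k]

/-- The completion `k((1/θ))` of the rational function field `k(θ)` at infinity. -/
abbrev KInf : Type := @RatFunc.CompletionAtInfty k _ (Classical.decEq _)

instance : CompleteSpace (KInf k) :=
  inferInstanceAs (CompleteSpace (@UniformSpace.Completion (RatFunc k)
    (@RatFunc.inftyValued k _ (Classical.decEq _)).toUniformSpace))

theorem valued_theta (k : Type) [Field k] :
    Valued.v (algebraMap (RatFunc k) (KInf k) RatFunc.X) = WithZero.exp (1 : ℤ) := by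
  classical
  rw [RatFunc.valuedCompletionAtInfty.def]
  let := @RatFunc.inftyValued k _ (Classical.decEq _)
  refine (Valued.extensionValuation_apply_coe (K := RatFunc k) RatFunc.X).trans ?_
  exact @RatFunc.inftyValuation.X k _ (Classical.decEq _)

theorem one_lt_card : (1 : ℝ≥0) < Fintype.card k := by
  exact_mod_cast Fintype.one_lt_card

open MonoidWithZeroHom in
/-- The valuation at infinity of `k((1/θ))`, read as an absolute value with `|θ| = #k`. -/
instance : (Valued.v : Valuation (KInf k) (WithZero (Multiplicative ℤ))).RankOne where
  hom' := (WithZeroMulInt.toNNReal (one_lt_card k).ne_zero).comp ValueGroup₀.embedding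
  strictMono' := (WithZeroMulInt.toNNReal_strictMono (one_lt_card k)).comp
    ValueGroup₀.embedding_strictMono
  exists_val_nontrivial :=
    ⟨algebraMap (RatFunc k) (KInf k) RatFunc.X, by rw [valued_theta]; simp, by
      rw [valued_theta]; simp [← WithZero.exp_zero]⟩

instance : NontriviallyNormedField (KInf k) :=
  Valued.toNontriviallyNormedField (KInf k) (WithZero (Multiplicative ℤ))

instance : IsUltrametricDist (KInf k) :=
  Valued.instIsUltrametricDist (KInf k) (WithZero (Multiplicative ℤ))

/-- An algebraic closure of `k((1/θ))`, with the unique extension of the absolute value. -/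
abbrev KInfAlg : Type := AlgebraicClosure (KInf k)

instance : NontriviallyNormedField (KInfAlg k) :=
  spectralNorm.nontriviallyNormedField (KInf k) (KInfAlg k)

instance : IsUltrametricDist (KInfAlg k) :=
  IsUltrametricDist.isUltrametricDist_of_forall_norm_add_le_max_norm
    (isNonarchimedean_spectralNorm (K := KInf k) (L := KInfAlg k))

/-- The field `ℂ_∞`: the completion of an algebraic closure of `k((1/θ))`. -/
def CInf : Type := UniformSpace.Completion (KInfAlg k)

instance : NormedField (CInf k) :=
  inferInstanceAs (NormedField (UniformSpace.Completion (KInfAlg k)))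

instance : CompleteSpace (CInf k) :=
  inferInstanceAs (CompleteSpace (UniformSpace.Completion (KInfAlg k)))

instance : Algebra (KInfAlg k) (CInf k) :=
  inferInstanceAs (Algebra (KInfAlg k) (UniformSpace.Completion (KInfAlg k)))

instance : IsUltrametricDist (CInf k) := by
  refine IsUltrametricDist.isUltrametricDist_of_forall_norm_add_le_max_norm fun x y ↦ ?_
  refine UniformSpace.Completion.induction_on₂ (α := KInfAlg k) (β := KInfAlg k)
    (p := fun x y ↦ ‖x + y‖ ≤ max ‖x‖ ‖y‖) x y ?_ fun a b ↦ ?_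
  · exact isClosed_le (by fun_prop) (by fun_prop)
  · rw [← UniformSpace.Completion.coe_add]
    simp only [UniformSpace.Completion.norm_coe]
    exact IsUltrametricDist.norm_add_le_max a b

/-- The embedding of `k(θ)` in `ℂ_∞`. -/
def ofRatFunc : RatFunc k →+* CInf k :=
  ((algebraMap (KInfAlg k) (CInf k)).comp (algebraMap (KInf k) (KInfAlg k))).comp
    (algebraMap (RatFunc k) (KInf k))

instance : Algebra k (CInf k) := ((ofRatFunc k).comp (algebraMap k (RatFunc k))).toAlgebra

/-- The element `θ` of `ℂ_∞`. -/
def theta : CInf k := ofRatFunc k RatFunc.X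

theorem one_lt_norm_theta : 1 < ‖theta k‖ := by
  have h : ‖theta k‖ = ‖algebraMap (RatFunc k) (KInf k) RatFunc.X‖ :=
    (UniformSpace.Completion.norm_coe (E := KInfAlg k) _).trans (spectralNorm_extends _)
  rw [h, Valued.toNormedField.one_lt_norm_iff, valued_theta]
  simp [← WithZero.exp_zero]

variable {k}

/-- The valuation `ord` of `ℂ_∞`, normalized by `ord θ = -1`, with `ord 0 = +∞`. -/
def ord (x : CInf k) : WithTop ℝ :=
  open scoped Classical in
  if x = 0 then ⊤ else ((-Real.logb ‖theta k‖ ‖x‖ : ℝ) : WithTop ℝ)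

theorem ord_theta : ord (theta k) = ((-1 : ℝ) : WithTop ℝ) := by
  have h := one_lt_norm_theta k
  have h0 : theta k ≠ 0 := norm_pos_iff.1 (by linarith)
  rw [ord, if_neg h0, Real.logb_self_eq_one h]

variable (k)

/-- The `q`-power Frobenius `x ↦ x ^ q` of `ℂ_∞`, where `q = #k`. -/
def frob : CInf k →+* CInf k := (FiniteField.frobeniusAlgHom k (CInf k)).toRingHom

@[simp]
theorem frob_apply (x : CInf k) : frob k x = x ^ Fintype.card k := rfl

theorem frob_algebraMap (c : k) : frob k (algebraMap k (CInf k) c) = algebraMap k (CInf k) c :=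
  (FiniteField.frobeniusAlgHom k (CInf k)).commutes c

/-- The action of the powers of the `q`-power Frobenius, which defines the twist of `ℂ_∞{τ}`. -/
instance : MulSemiringAction (Multiplicative ℕ) (CInf k) :=
  MulSemiringAction.compHom (CInf k) (powersHom (CInf k →+* CInf k) (frob k))

theorem phi_apply (x : CInf k) :
    SkewPolynomial.φ x = x ^ Fintype.card k := by
  change powersHom (CInf k →+* CInf k) (frob k) (Multiplicative.ofAdd 1) x = _
  simp

end ComplexNumbers

/-! ### The Anderson ring -/

section Ring

variable (k : Type) [Field k] [Fintype k]

/-- The ring `ℂ_∞{τ}` of non-commutative polynomials in `τ`, with `τ a = a ^ q τ`. -/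
abbrev TauRing : Type := SkewPolynomial (CInf k)

/-- The Anderson ring `ℂ_∞[T, τ]`: polynomials in a variable `T` commuting with `ℂ_∞{τ}`. -/
abbrev AndersonRing : Type := Polynomial (TauRing k)

/-- The element `τ` of the Anderson ring. -/
def tau : AndersonRing k := C SkewPolynomial.X

/-- The inclusion of `ℂ_∞[T]` in the Anderson ring. -/
def ofPoly : (CInf k)[X] →+* AndersonRing k := mapRingHom SkewPolynomial.CRingHom

/-- The inclusion of `ℂ_∞` in the Anderson ring. -/
def const : CInf k →+* AndersonRing k := C.comp SkewPolynomial.CRingHom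

/-- The endomorphism `∑ a_i T^i ↦ ∑ a_i^q T^i` of `ℂ_∞[T]`. -/
def polyFrob : (CInf k)[X] →+* (CInf k)[X] := mapRingHom (frob k)

theorem T_mul_const (a : CInf k) : (X : AndersonRing k) * const k a = const k a * X :=
  X_mul_C _

theorem T_mul_tau : (X : AndersonRing k) * tau k = tau k * X :=
  X_mul_C _

theorem tau_mul_const (a : CInf k) :
    tau k * const k a = const k (a ^ Fintype.card k) * tau k := by
  simp only [tau, const, RingHom.comp_apply, ← C_mul, SkewPolynomial.CRingHom_eq_C,
    ← SkewPolynomial.monomial_zero_left, SkewPolynomial.X_mul_monomial,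
    SkewPolynomial.monomial_mul_X, phi_apply]

theorem tau_mul_ofPoly (f : (CInf k)[X]) :
    tau k * ofPoly k f = ofPoly k (polyFrob k f) * tau k := by
  induction f using Polynomial.induction_on' with
  | add p q hp hq => simp only [map_add, mul_add, add_mul, hp, hq]
  | monomial n a =>
    have h := tau_mul_const k a
    simp only [const, RingHom.comp_apply] at h
    simp only [ofPoly, polyFrob, coe_mapRingHom, ← C_mul_X_pow_eq_monomial, Polynomial.map_mul,
      Polynomial.map_pow, map_C, map_X, frob_apply]
    rw [← mul_assoc, h, mul_assoc, mul_assoc, tau, X_pow_mul_C]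

end Ring

/-! ### The ring `ℂ_∞{T}` -/

section Tate

variable (k : Type) [Field k] [Fintype k]

/-- The ring `ℂ_∞{T}` of power series over `ℂ_∞` whose coefficients tend to `0`. -/
def Tate : Subring (PowerSeries (CInf k)) := PowerSeries.IsRestricted.subring 1

theorem mem_tate {f : PowerSeries (CInf k)} :
    f ∈ Tate k ↔ Filter.Tendsto (fun i ↦ PowerSeries.coeff i f) Filter.atTop (nhds 0) := by
  have h : f ∈ Tate k ↔ PowerSeries.IsRestricted 1 f := Iff.rfl
  rw [h, PowerSeries.isRestricted_iff',
    tendsto_zero_iff_norm_tendsto_zero (f := fun i ↦ PowerSeries.coeff i f)]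
  simp

/-- The inclusion of `ℂ_∞[T]` in `ℂ_∞{T}`. -/
def polyToTate : (CInf k)[X] →+* Tate k :=
  (Polynomial.coeToPowerSeries.ringHom (R := CInf k)).codRestrict (Tate k) fun f ↦ by
    rw [mem_tate]
    refine tendsto_const_nhds.congr' ?_
    filter_upwards [Filter.eventually_gt_atTop f.natDegree] with i hi
    simp [Polynomial.coeff_eq_zero_of_natDegree_lt hi]

instance : Algebra (CInf k)[X] (Tate k) := (polyToTate k).toAlgebra

/-- The action `∑ a_i T^i ↦ ∑ a_i^q T^i` of `τ` on `ℂ_∞{T}`. -/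
def tateFrob : Tate k →+* Tate k :=
  ((PowerSeries.map (frob k)).comp (Tate k).subtype).codRestrict (Tate k) fun f ↦ by
    have h := ((mem_tate k).1 f.2).pow (Fintype.card k)
    rw [zero_pow Fintype.card_ne_zero] at h
    rw [mem_tate]
    simpa using h

theorem tateFrob_polyToTate (f : (CInf k)[X]) :
    tateFrob k (polyToTate k f) = polyToTate k (polyFrob k f) := by
  ext i
  simp [tateFrob, polyToTate, polyFrob]

/-- `tateFrob` as a semilinear map over `ℂ_∞[T]`. -/
def tateFrobₛₗ : Tate k →ₛₗ[polyFrob k] Tate k where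
  toFun := tateFrob k
  map_add' := map_add _
  map_smul' f g := by
    rw [Algebra.smul_def, Algebra.smul_def, map_mul]
    exact congrArg (· * tateFrob k g) (tateFrob_polyToTate k f)

end Tate

/-! ### Cohomology of left modules over the Anderson ring -/

section Cohomology

variable (k : Type) [Field k] [Fintype k]
variable (M : Type) [AddCommGroup M] [Module (AndersonRing k) M]

/-- A left module over the Anderson ring, seen as a `ℂ_∞[T]`-module. -/
def OverPoly (_k M : Type) : Type := M

instance : AddCommGroup (OverPoly k M) := inferInstanceAs (AddCommGroup M)

instance : Module (AndersonRing k) (OverPoly k M) := inferInstanceAs (Module (AndersonRing k) M)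

instance : Module (CInf k)[X] (OverPoly k M) := Module.compHom (OverPoly k M) (ofPoly k)

theorem poly_smul_def (f : (CInf k)[X]) (m : OverPoly k M) : f • m = ofPoly k f • m := rfl

/-- The action of `τ` on a left module over the Anderson ring. -/
def tauₛₗ : OverPoly k M →ₛₗ[polyFrob k] OverPoly k M where
  toFun m := tau k • m
  map_add' := smul_add _
  map_smul' f m := by
    rw [poly_smul_def, poly_smul_def, smul_smul, smul_smul, tau_mul_ofPoly]

/-- The module `M{T}`, the base change of `M` from `ℂ_∞[T]` to `ℂ_∞{T}`. -/
def TateModule : Type := Tate k ⊗[(CInf k)[X]] OverPoly k M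

instance : AddCommGroup (TateModule k M) :=
  inferInstanceAs (AddCommGroup (Tate k ⊗[(CInf k)[X]] OverPoly k M))

instance : Module (CInf k)[X] (TateModule k M) :=
  inferInstanceAs (Module (CInf k)[X] (Tate k ⊗[(CInf k)[X]] OverPoly k M))

/-- The action of `k[T]` on `M{T}` by restriction of scalars. -/
instance : Module k[X] (TateModule k M) :=
  Module.compHom (TateModule k M) (mapRingHom (algebraMap k (CInf k)))

theorem smul_tateModule_def (f : k[X]) (x : TateModule k M) :
    f • x = f.map (algebraMap k (CInf k)) • x := rfl

/-- The action of `τ` on `M{T}`, with `τ (α ⊗ β) = τ α ⊗ τ β`. -/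
def tauTate : TateModule k M →ₛₗ[polyFrob k] TateModule k M :=
  TensorProduct.map (tateFrobₛₗ k) (tauₛₗ k M)

/-- The cohomology `H¹(M)`: the `k[T]`-module of `τ`-stable elements of `M{T}`. -/
def H1 : Submodule k[X] (TateModule k M) where
  carrier := {x | tauTate k M x = x}
  add_mem' {x y} hx hy := by
    change tauTate k M (x + y) = x + y
    rw [map_add, hx, hy]
  zero_mem' := map_zero (tauTate k M)
  smul_mem' f x hx := by
    change tauTate k M (f • x) = f • x
    have hf : polyFrob k (f.map (algebraMap k (CInf k))) = f.map (algebraMap k (CInf k)) := by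
      rw [polyFrob, coe_mapRingHom, map_map]
      congr 1
      exact RingHom.ext (frob_algebraMap k)
    rw [smul_tateModule_def, LinearMap.map_smulₛₗ, hf, hx]

/-- `h¹(M)`, the rank of `H¹(M)` over `k[T]`. -/
def h1 : ℕ := Module.finrank k[X] (H1 k M)

end Cohomology

/-! ### The t-motives `M(A)` -/

section Motive

variable {k : Type} [Field k] [Fintype k] {n : ℕ}

/-- The matrix `θ + A τ + τ²` over `ℂ_∞{τ}`. -/
def motiveMatrix (A : Matrix (Fin n) (Fin n) (CInf k)) : Matrix (Fin n) (Fin n) (TauRing k) :=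
  Matrix.diagonal (fun _ ↦ SkewPolynomial.C (theta k))
    + A.map (fun a ↦ SkewPolynomial.C a * SkewPolynomial.X)
    + Matrix.diagonal (fun _ ↦ SkewPolynomial.X ^ 2)

/-- The t-motive `M(A)`, free over `ℂ_∞{τ}` with basis `e_1, …, e_n`, on which `T` acts by
`T e_* = θ e_* + A τ e_* + τ² e_*`. An element is the row of its coordinates. -/
def Motive (_A : Matrix (Fin n) (Fin n) (CInf k)) : Type := Fin n → TauRing k

variable (A : Matrix (Fin n) (Fin n) (CInf k))

instance : AddCommGroup (Motive A) := inferInstanceAs (AddCommGroup (Fin n → TauRing k))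

instance : Module (TauRing k) (Motive A) :=
  inferInstanceAs (Module (TauRing k) (Fin n → TauRing k))

/-- Multiplication by `T` on `M(A)`; it is `ℂ_∞{τ}`-linear. -/
def mulT : Motive A →ₗ[TauRing k] Motive A := Matrix.vecMulLinear (motiveMatrix A)

/-- Multiplication by `T` on `M(A)` as an endomorphism of the additive group. -/
def mulTEnd : AddMonoid.End (Motive A) := (mulT A).toAddMonoidHom

/-- The action of the Anderson ring on `M(A)`. -/
def motiveHom : AndersonRing k →+* AddMonoid.End (Motive A) :=
  eval₂RingHom' (Module.toAddMonoidEnd (TauRing k) (Motive A)) (mulTEnd A)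
    fun a ↦ AddMonoidHom.ext fun m ↦ ((mulT A).map_smul a m).symm

instance : Module (AndersonRing k) (Motive A) := Module.compHom (Motive A) (motiveHom A)

/-- The basis elements `e_i` of `M(A)` over `ℂ_∞{τ}`. -/
def Motive.e (i : Fin n) : Motive A := Pi.single i (1 : TauRing k)

theorem T_smul (m : Motive A) : (X : AndersonRing k) • m = mulT A m := by
  change eval₂ (Module.toAddMonoidEnd (TauRing k) (Motive A)) (mulTEnd A) X m = _
  rw [eval₂_X]
  rfl

theorem C_smul (a : TauRing k) (m : Motive A) : (C a : AndersonRing k) • m = a • m := by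
  change eval₂ (Module.toAddMonoidEnd (TauRing k) (Motive A)) (mulTEnd A) (C a) m = _
  rw [eval₂_C]
  rfl

/-- The defining equation of `M(A)`. -/
theorem T_smul_e (i : Fin n) : (X : AndersonRing k) • Motive.e A i =
    const k (theta k) • Motive.e A i + ∑ j, const k (A i j) • tau k • Motive.e A j
      + tau k ^ 2 • Motive.e A i := by
  rw [T_smul]
  simp only [const, tau, RingHom.comp_apply, ← C_pow, C_smul, smul_smul]
  have h : ∀ (a : TauRing k) (j : Fin n), a • Motive.e A j = Pi.single j a := fun a j ↦ by
    funext l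
    change a * Pi.single (M := fun _ ↦ TauRing k) j 1 l = Pi.single (M := fun _ ↦ TauRing k) j a l
    by_cases hl : l = j
    · subst hl; simp
    · simp [hl]
  simp only [h]
  change Matrix.vecMul (Pi.single i 1) (motiveMatrix A) = _
  rw [Matrix.single_one_vecMul]
  funext l
  change motiveMatrix A i l = Pi.single (M := fun _ ↦ TauRing k) i _ l
    + (∑ j, Pi.single (M := fun _ ↦ TauRing k) j _) l + Pi.single (M := fun _ ↦ TauRing k) i _ l
  simp only [motiveMatrix, Matrix.add_apply, Matrix.map_apply, Matrix.diagonal_apply,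
    Finset.sum_apply, Pi.single_apply, eq_comm (a := i), Finset.sum_ite_eq, Finset.mem_univ,
    if_true]
  rfl

end Motive

/-- The open domain `D₁₃` of the `(u, v)`-plane between the rays `v = -q/(q+1), u ≥ -q/(q+1)` and
`v = -u/q - 1, u ≤ -q/(q+1)`; the value `u = +∞` is allowed. -/
def D13 (q : ℕ) : Set (WithTop ℝ × ℝ) :=
  {p | -((q : ℝ) / (q + 1)) < p.2 ∧ ((-q * p.2 - q : ℝ) : WithTop ℝ) < p.1}

end AndersonMotive

end

noncomputable section

open Polynomial
open scoped NNReal TensorProduct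

namespace AndersonMotive

/-! Over `ℂ_∞[T]` the module `M(A)` is free on e₁, e₂, τe₁, τe₂, and a τ-stable element of `M{T}` is
determined by its coordinates Σ xᵢTⁱ and Σ yᵢTⁱ along τe₁ and τe₂. Let Φ be the additive map (x, y)
↦ (θ²x⁴ + a₁₁x² + x + a₂₁y², θ²y⁴ + y + a₁₂x²). Stability means Φ(x₀, y₀) = 0 and Φ(xᵢ₊₁, yᵢ₊₁) =
(xᵢ⁴, yᵢ⁴). Thus H¹ is the space of null sequences obeying this recursion, with T acting as a shift.

The constant coefficient embeds H¹/T·H¹ in ker Φ. Eliminating y leaves a separable polynomial of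
degree 16 in x, so ker Φ has dimension 4 over 𝔽₂ (`card_coupledKernel`). The embedding is onto as
soon as every pair starts a null solution (`exists_recursion_sequence`). In D₁₃ one has |a₁₂||a₂₁|²
< |θ|². This makes the coupling of the two equations contracting for the size max(|x|, |a₂₁||y|²),
and the recursion can be solved so that this size shrinks at each step by the factor |θ|^(1/2).

Finite generation of H¹ is not known beforehand, so the rank is read off from H¹/T·H¹ by a
finiteness argument (`finrank_eq_of_filtration`). As ker Φ is discrete, the elements whose
coefficients are small from index n on form a finite group. This makes H¹ torsion modulo the span of
lifts of a basis of ker Φ, and these lifts are independent. -/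

/-! ### The field `ℂ_∞` is algebraically closed -/

/-- A complete nonarchimedean field with a dense algebraically closed subfield is algebraically
closed. -/
theorem isAlgClosed_of_denseRange {K L : Type*} [Field K] [NontriviallyNormedField L]
    [CompleteSpace L] [IsUltrametricDist L] [Algebra K L]
    (hi : DenseRange (algebraMap K L)) [IsAlgClosed K] : IsAlgClosed L := by
  apply IsAlgClosed.of_exists_root
  intro f fmon firr
  have fdeg : f.natDegree ≠ 0 := (Irreducible.natDegree_pos firr).ne'
  let F := f.SplittingField
  let : NormedField F := spectralNorm.normedField L F
  let : NormedAlgebra L F := spectralNorm.normedAlgebra L F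
  let a := rootOfSplits (SplittingField.splits f)
      (by simpa using degree_ne_of_natDegree_ne fdeg)
  have fa0 : f.aeval a = 0 := by
    rw [← eval_map_algebraMap]
    exact eval_rootOfSplits (Polynomial.SplittingField.splits f)
      (by simpa using degree_ne_of_natDegree_ne fdeg)
  have hiso : Isometry (algebraMap L F) := algebraMap_isometry L F
  have hcl : IsClosed (Set.range (algebraMap L F)) :=
    hiso.isClosedEmbedding.isClosed_range
  -- The image of `L` is closed by completeness, so it is enough to approximate `a` by roots of
  -- polynomials over `K`, all of which lie in `L`.
  have ha : a ∈ Set.range (algebraMap L F) := by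
    rw [← hcl.closure_eq, Metric.mem_closure_iff]
    intro δ δpos
    -- This tolerance on the coefficients turns the continuity-of-roots bound into exactly `δ`.
    have hε : (δ / (max ‖a‖ 1)) ^ f.natDegree / (f.natDegree + 1) > 0 := by positivity
    obtain ⟨g, gmon, gdeg, gcoeff⟩ :=
      exists_monic_and_natDegree_eq_and_norm_map_algebraMap_coeff_sub_lt hi fmon hε
    obtain ⟨b, hb, hab⟩ := exists_aroots_norm_sub_lt_of_norm_coeff_sub_lt
        hε fa0 fmon (gmon.map _) (gdeg ▸ (g.natDegree_map _)) gcoeff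
        (by simpa [Polynomial.map_map] using (IsAlgClosed.splits g).map ((algebraMap L F).comp _))
    refine ⟨b, ?_, ?_⟩
    · rw [Polynomial.aroots_def, Splits.roots_map ((IsAlgClosed.splits g).map _),
        Multiset.mem_map] at hb
      obtain ⟨c, _, hc⟩ := hb
      exact ⟨c, hc⟩
    · rw [dist_eq_norm]
      rw [← Real.rpow_natCast, ← mul_comm_div, div_self, one_mul,
        ← Real.rpow_mul (div_pos δpos (by positivity)).le, mul_inv_cancel₀] at hab
      · simpa [mul_assoc, div_mul_cancel₀ _ (by positivity : (max ‖a‖ 1) > 0).ne'] using hab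
      · simp [fdeg]
      · positivity
  obtain ⟨x, hx⟩ := ha
  refine ⟨x, (algebraMap L F).injective ?_⟩
  rw [← Polynomial.aeval_algebraMap_apply_eq_algebraMap_eval, hx, fa0, map_zero]

instance isAlgClosed_CInf (k : Type) [Field k] [Fintype k] : IsAlgClosed (CInf k) := by
  let : NontriviallyNormedField (CInf k) :=
    { (inferInstance : NormedField (CInf k)) with non_trivial := ⟨_, one_lt_norm_theta k⟩ }
  exact isAlgClosed_of_denseRange (K := KInfAlg k)
    (UniformSpace.Completion.denseRange_coe (α := KInfAlg k))

instance charP_CInf : CharP (CInf (ZMod 2)) 2 :=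
  charP_of_injective_algebraMap (algebraMap (ZMod 2) (CInf (ZMod 2))).injective 2

/-! ### Small roots of polynomials -/

section Roots

variable {F : Type*} [NormedField F] [IsUltrametricDist F]

/-- Multiplying by `X - r` multiplies the constant coefficient by `-r`, and the ultrametric
inequality controls the new linear coefficient. Both bounds therefore pass from `s` to `r ::ₘ s`. -/
theorem norm_coeff_one_mul_le_of_le_norm_roots {ρ : ℝ} (hρ : 0 ≤ ρ) (s : Multiset F)
    (hs : ∀ r ∈ s, ρ ≤ ‖r‖) :
    ‖(s.map fun r ↦ X - C r).prod.coeff 1‖ * ρ ≤ ‖(s.map fun r ↦ X - C r).prod.coeff 0‖ ∧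
      ρ ^ s.card ≤ ‖(s.map fun r ↦ X - C r).prod.coeff 0‖ := by
  induction s using Multiset.induction_on with
  | empty => simp [coeff_one]
  | cons r s ih =>
    obtain ⟨h1, h0⟩ := ih fun t ht ↦ hs t (Multiset.mem_cons_of_mem ht)
    have hr := hs r (Multiset.mem_cons_self r s)
    set p := (s.map fun r ↦ X - C r).prod with hp
    have e0 : ((X - C r) * p).coeff 0 = -(r * p.coeff 0) := by
      simp [mul_coeff_zero]
    have e1 : ((X - C r) * p).coeff 1 = p.coeff 0 - r * p.coeff 1 := by
      rw [sub_mul, coeff_sub, coeff_C_mul, coeff_X_mul]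
    simp only [Multiset.map_cons, Multiset.prod_cons, Multiset.card_cons, ← hp]
    rw [e0, e1, norm_neg, norm_mul]
    constructor
    · have h := IsUltrametricDist.norm_add_le_max (p.coeff 0) (-(r * p.coeff 1))
      rw [← sub_eq_add_neg, norm_neg, norm_mul] at h
      rcases le_max_iff.1 h with h | h
      · calc _ ≤ ‖p.coeff 0‖ * ρ := by gcongr
          _ ≤ ‖p.coeff 0‖ * ‖r‖ := by gcongr
          _ = _ := mul_comm _ _
      · calc _ ≤ ‖r‖ * ‖p.coeff 1‖ * ρ := by gcongr
          _ = ‖r‖ * (‖p.coeff 1‖ * ρ) := by ring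
          _ ≤ _ := by gcongr
    · rw [pow_succ, mul_comm]
      gcongr

/-- A root of least absolute value of a polynomial that splits is bounded by the two ends of the
Newton polygon and by its first slope. -/
theorem exists_root_norm_le {p : F[X]} (hp : p.Splits) (hd : p.natDegree ≠ 0) :
    ∃ r, p.eval r = 0 ∧ ‖p.coeff 1‖ * ‖r‖ ≤ ‖p.coeff 0‖ ∧
      ‖p.leadingCoeff‖ * ‖r‖ ^ p.natDegree ≤ ‖p.coeff 0‖ := by
  classical
  have hp0 : p ≠ 0 := fun h ↦ hd (by simp [h])
  have hcard := hp.natDegree_eq_card_roots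
  have hne : p.roots.toFinset.Nonempty := by
    rw [Finset.nonempty_iff_ne_empty, ne_eq, Multiset.toFinset_eq_empty, ← Multiset.card_eq_zero,
      ← hcard]
    exact hd
  obtain ⟨r, hr, hmin⟩ := p.roots.toFinset.exists_min_image (fun r ↦ ‖r‖) hne
  rw [Multiset.mem_toFinset] at hr
  obtain ⟨h1, h0⟩ := norm_coeff_one_mul_le_of_le_norm_roots (norm_nonneg r) p.roots
    fun t ht ↦ hmin t (Multiset.mem_toFinset.2 ht)
  have hc : ∀ i, p.coeff i = p.leadingCoeff * (p.roots.map fun r ↦ X - C r).prod.coeff i := by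
    intro i
    conv_lhs => rw [hp.eq_prod_roots]
    rw [coeff_C_mul]
  refine ⟨r, (mem_roots hp0).1 hr, ?_, ?_⟩
  · rw [hc 1, hc 0, norm_mul, norm_mul, mul_assoc]
    gcongr
  · rw [hc 0, norm_mul, hcard]
    gcongr

/-- The root of least absolute value works. The linear coefficient 1 gives the first bound and the
leading coefficient the second; the middle coefficient `a` plays no role in either. -/
theorem exists_additive_quartic_root [IsAlgClosed F] {b : F} (hb : b ≠ 0) (a w : F) :
    ∃ x : F, b * x ^ 4 + a * x ^ 2 + x = w ∧ ‖x‖ ≤ ‖w‖ ∧ ‖b‖ * ‖x‖ ^ 4 ≤ ‖w‖ := by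
  let p : F[X] := C b * X ^ 4 + (C a * X ^ 2 + X - C w)
  have hlow : (C a * X ^ 2 + X - C w).natDegree < 4 := by
    have : (C a * X ^ 2 + X - C w).natDegree ≤ 2 := by compute_degree
    omega
  have hd : p.natDegree = 4 := by
    rw [natDegree_add_eq_left_of_natDegree_lt] <;> rw [natDegree_C_mul_X_pow _ _ hb]
    exact hlow
  have hl : p.leadingCoeff = b := by
    rw [leadingCoeff, hd]
    simp only [p, coeff_add, coeff_C_mul_X_pow]
    rw [if_pos trivial, coeff_eq_zero_of_natDegree_lt hlow, add_zero]
  obtain ⟨r, h, h1, h2⟩ := exists_root_norm_le (IsAlgClosed.splits p) (by rw [hd]; norm_num)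
  have c0 : p.coeff 0 = -w := by simp [p]
  have c1 : p.coeff 1 = 1 := by simp [p, coeff_X]
  rw [c0, c1, norm_neg, norm_one, one_mul] at h1
  rw [hl, c0, hd, norm_neg] at h2
  refine ⟨r, ?_, h1, h2⟩
  simp only [p, eval_add, eval_sub, eval_mul, eval_C, eval_pow, eval_X] at h
  linear_combination h

end Roots

/-! ### The coupled additive equations -/

section Coupled

open Filter Topology

variable {F : Type*} [NormedField F]

theorem add_pow_four [CharP F 2] (x y : F) : (x + y) ^ 4 = x ^ 4 + y ^ 4 := by
  have h := CharTwo.add_sq x y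
  calc (x + y) ^ 4 = ((x + y) ^ 2) ^ 2 := by ring
    _ = _ := by rw [h, CharTwo.add_sq]; ring

variable [IsUltrametricDist F]

theorem norm_sum_range_le {x : ℕ → F} {M : ℝ} (hM : 0 ≤ M) (h : ∀ n, ‖x n‖ ≤ M) (n : ℕ) :
    ‖∑ i ∈ Finset.range n, x i‖ ≤ M :=
  IsUltrametricDist.norm_sum_le_of_forall_le_of_nonneg hM fun i _ ↦ h i

variable [CompleteSpace F]

theorem exists_tendsto_sum_range {x : ℕ → F} (h : Tendsto x atTop (𝓝 0)) :
    ∃ s, Tendsto (fun n ↦ ∑ i ∈ Finset.range n, x i) atTop (𝓝 s) := by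
  have := NonarchimedeanAddGroup.summable_of_tendsto_cofinite_zero (f := x)
    (by rwa [Nat.cofinite_eq_atTop])
  exact ⟨_, this.hasSum.tendsto_sum_nat⟩

variable [IsAlgClosed F] [CharP F 2]

/-- A solution of the uncoupled equations can be corrected to one of the coupled equations without
loss of size. -/
theorem exists_coupled_solution {a b c d : F} (hb : b ≠ 0) (hc : c ≠ 0)
    (hd : ‖d‖ * ‖c‖ ^ 2 < ‖b‖) {x₀ y₀ : F} {M : ℝ} (hx₀ : ‖x₀‖ ≤ M) (hy₀ : ‖c‖ * ‖y₀‖ ^ 2 ≤ M) :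
    ∃ x y : F, b * x ^ 4 + a * x ^ 2 + x + c * y ^ 2 = b * x₀ ^ 4 + a * x₀ ^ 2 + x₀ ∧
      b * y ^ 4 + y + d * x ^ 2 = b * y₀ ^ 4 + y₀ ∧ ‖x‖ ≤ M ∧ ‖c‖ * ‖y‖ ^ 2 ≤ M := by
  have hb' : 0 < ‖b‖ := norm_pos_iff.2 hb
  have hc' : 0 < ‖c‖ := norm_pos_iff.2 hc
  have hM : 0 ≤ M := (norm_nonneg _).trans hx₀
  -- The contraction factor is a fourth root of `‖d‖ * ‖c‖ ^ 2 / ‖b‖`; the maximum with 1/2 keeps it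
  -- positive when `d = 0`.
  obtain ⟨μ, hμ0, hμ1, hμ⟩ : ∃ μ : ℝ, 0 < μ ∧ μ < 1 ∧ ‖d‖ * ‖c‖ ^ 2 ≤ μ ^ 4 * ‖b‖ := by
    have ht : ‖d‖ * ‖c‖ ^ 2 / ‖b‖ < 1 := (div_lt_one hb').2 hd
    set s := max (‖d‖ * ‖c‖ ^ 2 / ‖b‖) (1 / 2) with hs
    have hs0 : 0 < s := lt_max_of_lt_right (by norm_num)
    have hs1 : s < 1 := max_lt ht (by norm_num)
    refine ⟨√√s, by positivity, ?_, ?_⟩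
    · rw [Real.sqrt_lt' one_pos, one_pow, Real.sqrt_lt' one_pos, one_pow]
      exact hs1
    · have : √√s ^ 4 = s := by
        rw [show 4 = 2 * 2 from rfl, pow_mul, Real.sq_sqrt (by positivity),
          Real.sq_sqrt hs0.le]
      rw [this, ← div_le_iff₀ hb']
      exact le_max_left _ _
  choose G hG hG1 hG4 using exists_additive_quartic_root hb a
  choose H hH hH1 hH4 using exists_additive_quartic_root hb (0 : F)
  -- Successive corrections: each pair solves the uncoupled equations with the coupling terms of the
  -- previous pair on the right. In characteristic 2 adding it cancels those terms, and the solution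
  -- is the sum of the series.
  let s : ℕ → F × F := fun n ↦ Nat.rec (x₀, y₀) (fun _ p ↦ (G (c * p.2 ^ 2), H (d * p.1 ^ 2))) n
  let x : ℕ → F := fun n ↦ (s n).1
  let y : ℕ → F := fun n ↦ (s n).2
  -- The first equation uses the bound from the linear term, the second the bound from the leading
  -- term. In the weighted size, passing from `y` to `x` loses nothing and passing from `x` to `y`
  -- gains `μ ^ 2`.
  have hx : ∀ n, ‖x (n + 1)‖ ≤ ‖c‖ * ‖y n‖ ^ 2 := fun n ↦ by
    rw [← norm_pow, ← norm_mul]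
    exact hG1 (c * y n ^ 2)
  have hy : ∀ n, ‖c‖ * ‖y (n + 1)‖ ^ 2 ≤ μ ^ 2 * ‖x n‖ := fun n ↦ by
    have h : ‖b‖ * ‖y (n + 1)‖ ^ 4 ≤ ‖d‖ * ‖x n‖ ^ 2 := by
      rw [← norm_pow (x n), ← norm_mul]
      exact hH4 (d * x n ^ 2)
    refine le_of_sq_le_sq ?_ (by positivity)
    refine le_of_mul_le_mul_left ?_ hb'
    calc ‖b‖ * (‖c‖ * ‖y (n + 1)‖ ^ 2) ^ 2 = ‖c‖ ^ 2 * (‖b‖ * ‖y (n + 1)‖ ^ 4) := by ring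
      _ ≤ ‖c‖ ^ 2 * (‖d‖ * ‖x n‖ ^ 2) := by gcongr
      _ = ‖d‖ * ‖c‖ ^ 2 * ‖x n‖ ^ 2 := by ring
      _ ≤ μ ^ 4 * ‖b‖ * ‖x n‖ ^ 2 := by gcongr
      _ = _ := by ring
  have hbound : ∀ n, ‖x n‖ ≤ M ∧ ‖c‖ * ‖y n‖ ^ 2 ≤ M := fun n ↦ by
    induction n with
    | zero => exact ⟨hx₀, hy₀⟩
    | succ n ih =>
      refine ⟨(hx n).trans ih.2, (hy n).trans ?_⟩
      calc μ ^ 2 * ‖x n‖ ≤ 1 * M := by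
            gcongr
            · exact pow_le_one₀ hμ0.le hμ1.le
            · exact ih.1
        _ = M := one_mul M
  -- The gain `μ ^ 2` comes once in two steps; the extra `μ` in front of `‖x n‖` spreads it evenly
  -- as one `μ` per step.
  have hdecay : ∀ n, μ * ‖x n‖ ≤ μ ^ n * M ∧ ‖c‖ * ‖y n‖ ^ 2 ≤ μ ^ n * M := fun n ↦ by
    induction n with
    | zero =>
      refine ⟨?_, by rw [pow_zero, one_mul]; exact hy₀⟩
      calc μ * ‖x 0‖ ≤ 1 * M := by gcongr; exact hx₀
        _ = _ := by simp
    | succ n ih =>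
      constructor
      · calc μ * ‖x (n + 1)‖ ≤ μ * (μ ^ n * M) := by gcongr; exact (hx n).trans ih.2
          _ = _ := by ring
      · calc ‖c‖ * ‖y (n + 1)‖ ^ 2 ≤ μ * (μ * ‖x n‖) := (hy n).trans_eq (by ring)
          _ ≤ μ * (μ ^ n * M) := mul_le_mul_of_nonneg_left ih.1 hμ0.le
          _ = _ := by ring
  have hpow : Tendsto (fun n ↦ μ ^ n * M) atTop (𝓝 0) := by
    simpa using (tendsto_pow_atTop_nhds_zero_of_lt_one hμ0.le hμ1).mul_const M
  have hxt : Tendsto x atTop (𝓝 0) := by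
    rw [tendsto_zero_iff_norm_tendsto_zero]
    have := squeeze_zero (fun n ↦ by positivity) (fun n ↦ (hdecay n).1) hpow
    simpa [hμ0.ne'] using this.const_mul μ⁻¹
  have hyt : Tendsto y atTop (𝓝 0) := by
    have := squeeze_zero (fun n ↦ by positivity) (fun n ↦ (hdecay n).2) hpow
    have h2 : Tendsto (fun n ↦ ‖y n‖ ^ 2) atTop (𝓝 0) := by
      simpa [hc'.ne'] using this.const_mul ‖c‖⁻¹
    rw [tendsto_zero_iff_norm_tendsto_zero]
    simpa using h2.sqrt
  obtain ⟨sx, hsx⟩ := exists_tendsto_sum_range hxt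
  obtain ⟨sy, hsy⟩ := exists_tendsto_sum_range hyt
  have hgx : ∀ n, b * x (n + 1) ^ 4 + a * x (n + 1) ^ 2 + x (n + 1) = c * y n ^ 2 :=
    fun n ↦ hG (c * y n ^ 2)
  have hhy : ∀ n, b * y (n + 1) ^ 4 + y (n + 1) = d * x n ^ 2 := fun n ↦ by
    have := hH (d * x n ^ 2)
    rwa [zero_mul, add_zero] at this
  have two : (2 : F) = 0 := CharTwo.two_eq_zero
  -- The coupling sum stops one term earlier because its last term is what the next correction
  -- cancels.
  have eq1 : ∀ n, b * (∑ i ∈ Finset.range (n + 1), x i) ^ 4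
      + a * (∑ i ∈ Finset.range (n + 1), x i) ^ 2 + ∑ i ∈ Finset.range (n + 1), x i
      + c * (∑ i ∈ Finset.range n, y i) ^ 2 = b * x₀ ^ 4 + a * x₀ ^ 2 + x₀ := fun n ↦ by
    induction n with
    | zero => simp [x, s]
    | succ n ih =>
      rw [Finset.sum_range_succ x, Finset.sum_range_succ y, add_pow_four, CharTwo.add_sq,
        CharTwo.add_sq]
      linear_combination ih + hgx n + c * y n ^ 2 * two
  have eq2 : ∀ n, b * (∑ i ∈ Finset.range (n + 1), y i) ^ 4 + ∑ i ∈ Finset.range (n + 1), y i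
      + d * (∑ i ∈ Finset.range n, x i) ^ 2 = b * y₀ ^ 4 + y₀ := fun n ↦ by
    induction n with
    | zero => simp [y, s]
    | succ n ih =>
      rw [Finset.sum_range_succ x, Finset.sum_range_succ y, add_pow_four, CharTwo.add_sq]
      linear_combination ih + hhy n + d * x n ^ 2 * two
  have hsx' := hsx.comp (tendsto_add_atTop_nat 1)
  have hsy' := hsy.comp (tendsto_add_atTop_nat 1)
  refine ⟨sx, sy, ?_, ?_, ?_, ?_⟩
  · refine tendsto_nhds_unique (l := atTop) ?_ (tendsto_const_nhds.congr fun n ↦ (eq1 n).symm)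
    exact ((((hsx'.pow 4).const_mul b).add ((hsx'.pow 2).const_mul a)).add hsx').add
      ((hsy.pow 2).const_mul c)
  · refine tendsto_nhds_unique (l := atTop) ?_ (tendsto_const_nhds.congr fun n ↦ (eq2 n).symm)
    exact (((hsy'.pow 4).const_mul b).add hsy').add ((hsx.pow 2).const_mul d)
  · exact le_of_tendsto hsx.norm (Eventually.of_forall
      fun n ↦ norm_sum_range_le hM (fun i ↦ (hbound i).1) n)
  · have hyM : ∀ i, ‖y i‖ ≤ √(M / ‖c‖) := fun i ↦ by
      refine Real.le_sqrt_of_sq_le ?_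
      rw [le_div_iff₀ hc', mul_comm]
      exact (hbound i).2
    have h : ‖sy‖ ≤ √(M / ‖c‖) := le_of_tendsto hsy.norm (Eventually.of_forall
      fun n ↦ norm_sum_range_le (Real.sqrt_nonneg _) hyM n)
    calc ‖c‖ * ‖sy‖ ^ 2 ≤ ‖c‖ * √(M / ‖c‖) ^ 2 := by gcongr
      _ = M := by rw [Real.sq_sqrt (by positivity)]; field_simp

/-- One step of the recursion: the weighted size `max ‖x‖ (‖c‖ * ‖y‖ ^ 2)` shrinks by the fourth
root of `‖b‖`. -/
theorem exists_recursion_step {a b c d : F} (hc : c ≠ 0) {l : ℝ} (hl : 1 < l) (hb : ‖b‖ = l ^ 4)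
    (hd : ‖d‖ * ‖c‖ ^ 2 < ‖b‖) (x y : F) {M : ℝ} (hx : ‖x‖ ≤ M) (hy : ‖c‖ * ‖y‖ ^ 2 ≤ M) :
    ∃ x' y' : F, b * x' ^ 4 + a * x' ^ 2 + x' + c * y' ^ 2 = x ^ 4 ∧
      b * y' ^ 4 + y' + d * x' ^ 2 = y ^ 4 ∧ ‖x'‖ ≤ M / l ∧ ‖c‖ * ‖y'‖ ^ 2 ≤ M / l := by
  have hl0 : 0 < l := by linarith
  have hb0 : b ≠ 0 := norm_pos_iff.1 (by rw [hb]; positivity)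
  have hM : 0 ≤ M := (norm_nonneg _).trans hx
  obtain ⟨x₀, h1, -, h3⟩ := exists_additive_quartic_root hb0 a (x ^ 4)
  obtain ⟨y₀, h4, -, h6⟩ := exists_additive_quartic_root hb0 0 (y ^ 4)
  have key : ∀ {z w : F}, ‖b‖ * ‖z‖ ^ 4 ≤ ‖w ^ 4‖ → ‖z‖ ≤ ‖w‖ / l := fun {z w} h ↦ by
    rw [le_div_iff₀ hl0]
    refine le_of_pow_le_pow_left₀ (n := 4) (by norm_num) (norm_nonneg w) ?_
    rw [mul_pow, mul_comm, ← hb, ← norm_pow w]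
    exact h
  have hx₀ : ‖x₀‖ ≤ M / l := (key h3).trans (by gcongr)
  -- The square in the weight yields a gain of `l ^ 2`, of which only `l` is kept.
  have hy₀ : ‖c‖ * ‖y₀‖ ^ 2 ≤ M / l := by
    calc ‖c‖ * ‖y₀‖ ^ 2 ≤ ‖c‖ * (‖y‖ / l) ^ 2 := by gcongr; exact key h6
      _ = ‖c‖ * ‖y‖ ^ 2 / l / l := by field_simp
      _ ≤ ‖c‖ * ‖y‖ ^ 2 / l := div_le_self (by positivity) hl.le
      _ ≤ M / l := by gcongr
  obtain ⟨x', y', e1, e2, e3, e4⟩ := exists_coupled_solution (a := a) hb0 hc hd hx₀ hy₀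
  refine ⟨x', y', e1.trans h1, e2.trans ?_, e3, e4⟩
  rw [← h4, zero_mul, add_zero]

/-- Every pair is the first term of a sequence that tends to zero and solves the recursion. -/
theorem exists_recursion_sequence {a b c d : F} (hc : c ≠ 0) (hb : 1 < ‖b‖)
    (hd : ‖d‖ * ‖c‖ ^ 2 < ‖b‖) (x₀ y₀ : F) :
    ∃ x y : ℕ → F, x 0 = x₀ ∧ y 0 = y₀ ∧ Tendsto x atTop (𝓝 0) ∧ Tendsto y atTop (𝓝 0) ∧
      ∀ n, b * x (n + 1) ^ 4 + a * x (n + 1) ^ 2 + x (n + 1) + c * y (n + 1) ^ 2 = x n ^ 4 ∧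
        b * y (n + 1) ^ 4 + y (n + 1) + d * x (n + 1) ^ 2 = y n ^ 4 := by
  have hc' : 0 < ‖c‖ := norm_pos_iff.2 hc
  obtain ⟨l, hl, hbl⟩ : ∃ l : ℝ, 1 < l ∧ ‖b‖ = l ^ 4 := by
    refine ⟨√√‖b‖, ?_, ?_⟩
    · rw [Real.lt_sqrt zero_le_one, one_pow, Real.lt_sqrt zero_le_one, one_pow]
      exact hb
    · rw [show 4 = 2 * 2 from rfl, pow_mul, Real.sq_sqrt (by positivity),
        Real.sq_sqrt (norm_nonneg b)]
  have hl0 : 0 < l := by linarith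
  choose f g h1 h2 h3 h4 using fun p : F × F ↦ exists_recursion_step (a := a) hc hl hbl hd p.1 p.2
    (le_max_left ‖p.1‖ (‖c‖ * ‖p.2‖ ^ 2)) (le_max_right _ _)
  let s : ℕ → F × F := fun n ↦ Nat.rec (x₀, y₀) (fun _ p ↦ (f p, g p)) n
  let N : F × F → ℝ := fun p ↦ max ‖p.1‖ (‖c‖ * ‖p.2‖ ^ 2)
  have hN : ∀ n, N (s n) ≤ (1 / l) ^ n * N (x₀, y₀) := fun n ↦ by
    induction n with
    | zero => simp [s]
    | succ n ih =>
      calc N (s (n + 1)) ≤ N (s n) / l := max_le (h3 _) (h4 _)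
        _ ≤ (1 / l) ^ n * N (x₀, y₀) / l := by gcongr
        _ = _ := by rw [pow_succ]; ring
  have hlim : Tendsto (fun n ↦ (1 / l) ^ n * N (x₀, y₀)) atTop (𝓝 0) := by
    have : 1 / l < 1 := (div_lt_one hl0).2 hl
    simpa using (tendsto_pow_atTop_nhds_zero_of_lt_one (by positivity) this).mul_const _
  refine ⟨fun n ↦ (s n).1, fun n ↦ (s n).2, rfl, rfl, ?_, ?_, fun n ↦ ⟨h1 (s n), h2 (s n)⟩⟩
  · rw [tendsto_zero_iff_norm_tendsto_zero]
    exact squeeze_zero (fun n ↦ norm_nonneg _) (fun n ↦ (le_max_left _ _).trans (hN n)) hlim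
  · have := squeeze_zero (fun n ↦ by positivity)
      (fun n ↦ (le_max_right ‖(s n).1‖ (‖c‖ * ‖(s n).2‖ ^ 2)).trans (hN n)) hlim
    have h2 : Tendsto (fun n ↦ ‖(s n).2‖ ^ 2) atTop (𝓝 0) := by
      simpa [hc'.ne'] using this.const_mul ‖c‖⁻¹
    rw [tendsto_zero_iff_norm_tendsto_zero]
    simpa using h2.sqrt

end Coupled

/-! ### The rank of a module from its reduction modulo the variable -/

section Rank

variable {k : Type*} [Field k] {H K : Type*} [AddCommGroup H] [Module k[X] H]
  [AddCommGroup K]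

/-- An element of `W (n + 1)` differs from a chosen element with the same value of `ε` by `X • w'`
with `w'` in `W n`. Hence `W (n + 1)` has at most `#K * #(W n)` elements. -/
theorem finite_of_filtration [Finite K] (ε : H →+ K) (W : ℕ → AddSubgroup H)
    (hker : ∀ h, ε h = 0 → ∃ h', h = (X : k[X]) • h')
    (hW0 : W 0 = ⊥) (hWX : ∀ n h, (X : k[X]) • h ∈ W (n + 1) → h ∈ W n) (n : ℕ) :
    (W n : Set H).Finite := by
  classical
  induction n with
  | zero => simp [hW0]
  | succ n ih =>
    let g : K → H := fun κ ↦ if h : ∃ w ∈ W (n + 1), ε w = κ then h.choose else 0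
    have hg : ∀ w ∈ W (n + 1), g (ε w) ∈ W (n + 1) ∧ ε (g (ε w)) = ε w := fun w hw ↦ by
      have h : ∃ w' ∈ W (n + 1), ε w' = ε w := ⟨w, hw, rfl⟩
      simp only [g, dif_pos h]
      exact h.choose_spec
    refine ((Set.finite_univ (α := K)).image2 (fun κ h ↦ g κ + (X : k[X]) • h) ih).subset ?_
    intro w hw
    obtain ⟨h1, h2⟩ := hg w hw
    obtain ⟨w', hw'⟩ := hker (w - g (ε w)) (by rw [map_sub, h2, sub_self])
    refine ⟨ε w, Set.mem_univ _, w', hWX n w' ?_, ?_⟩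
    · rw [← hw']
      exact sub_mem hw h1
    · change g (ε w) + (X : k[X]) • w' = w
      rw [← hw', add_sub_cancel]

variable [Module k K]

/-- Applying `ε` to a relation shows that all its coefficients are divisible by `X`. Cancelling `X`
gives another relation, so they are divisible by every power of `X`. -/
theorem linearIndependent_of_constantCoeff {ι : Type*} [Fintype ι] (ε : H →+ K)
    (hε : ∀ (p : k[X]) (h : H), ε (p • h) = p.coeff 0 • ε h)
    (hinj : ∀ h : H, (X : k[X]) • h = 0 → h = 0)
    {b : ι → H} (hb : LinearIndependent k fun i ↦ ε (b i)) : LinearIndependent k[X] b := by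
  have key : ∀ (n : ℕ) (p : ι → k[X]), ∑ i, p i • b i = 0 → ∀ i, X ^ n ∣ p i := by
    intro n
    induction n with
    | zero => simp
    | succ n ih =>
      intro p hp
      have h0 : ∀ i, (p i).coeff 0 = 0 := by
        refine Fintype.linearIndependent_iff.1 hb (fun i ↦ (p i).coeff 0) ?_
        have := congrArg ε hp
        rw [map_sum, map_zero] at this
        simpa only [hε] using this
      choose q hq using fun i ↦ X_dvd_iff.2 (h0 i)
      have hq0 : ∑ i, q i • b i = 0 := by
        refine hinj _ ?_
        rw [Finset.smul_sum, ← hp]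
        exact Finset.sum_congr rfl fun i _ ↦ by rw [hq i, mul_smul]
      intro i
      rw [hq i, pow_succ']
      exact mul_dvd_mul_left X (ih q hq0 i)
  refine Fintype.linearIndependent_iff.2 fun p hp i ↦ ?_
  ext n
  exact X_pow_dvd_iff.1 (key (n + 1) p hp i) n n.lt_succ_self

/-- Let `ε` identify `H / X H` with a finite space `K`, and let `H` be exhausted by subgroups `W n`
that shrink under division by `X`. Then the rank of `H` is the dimension of `K`. -/
theorem finrank_eq_of_filtration [Finite K] (ε : H →+ K) (W : ℕ → AddSubgroup H)
    (hε : ∀ (p : k[X]) (h : H), ε (p • h) = p.coeff 0 • ε h)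
    (hinj : ∀ h : H, (X : k[X]) • h = 0 → h = 0)
    (hker : ∀ h, ε h = 0 → ∃ h', h = (X : k[X]) • h') (hsurj : Function.Surjective ε)
    (hmono : Monotone W) (hW : ∀ h, ∃ n, h ∈ W n) (hW0 : W 0 = ⊥)
    (hWX : ∀ n h, (X : k[X]) • h ∈ W (n + 1) → h ∈ W n)
    (hWC : ∀ n (c : k), ∀ h ∈ W n, (C c : k[X]) • h ∈ W n) :
    Module.finrank k[X] H = Module.finrank k K := by
  have hfin := finite_of_filtration ε W hker hW0 hWX
  have : Module.Finite k K := Module.Finite.of_finite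
  let B := Module.finBasis k K
  choose b hb using fun i ↦ hsurj (B i)
  have hli : LinearIndependent k[X] b := by
    refine linearIndependent_of_constantCoeff ε hε hinj ?_
    simpa only [hb] using B.linearIndependent
  let S := Submodule.span k[X] (Set.range b)
  -- A constant combination of the `b i` has the same image under `ε` as `w`; the difference is
  -- divisible by `X`, and the quotient stays in the same `W n`.
  have hdiv : ∀ n, (∀ i, b i ∈ W n) → ∀ w ∈ W n, ∃ w' ∈ W n, w - (X : k[X]) • w' ∈ S := by
    intro n hn w hw
    let s := ∑ i, (C (B.repr (ε w) i) : k[X]) • b i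
    have hs : s ∈ S := S.sum_mem fun i _ ↦ S.smul_mem _ (Submodule.subset_span ⟨i, rfl⟩)
    have hεs : ε s = ε w := by
      simp only [s, map_sum, hε, coeff_C_zero, hb]
      exact B.sum_repr _
    obtain ⟨w', hw'⟩ := hker (w - s) (by rw [map_sub, hεs, sub_self])
    refine ⟨w', hWX n w' (hmono n.le_succ ?_), ?_⟩
    · rw [← hw']
      exact sub_mem hw (sum_mem fun i _ ↦ hWC n _ _ (hn i))
    · rwa [← hw', sub_sub_cancel]
  have htors : Module.IsTorsion k[X] (H ⧸ S) := by
    intro x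
    obtain ⟨h, rfl⟩ := Submodule.Quotient.mk_surjective S x
    obtain ⟨n, hnh, hnb⟩ : ∃ n, h ∈ W n ∧ ∀ i, b i ∈ W n := by
      choose m hm using fun i ↦ hW (b i)
      obtain ⟨m', hm'⟩ := hW h
      refine ⟨m' + ∑ i, m i, hmono (Nat.le_add_right _ _) hm', fun i ↦ hmono ?_ (hm i)⟩
      exact (Finset.single_le_sum (f := m) (fun _ _ ↦ Nat.zero_le _) (Finset.mem_univ i)).trans
        (Nat.le_add_left _ _)
    choose! f hf hfS using hdiv n hnb
    have hmem : ∀ m, f^[m] h ∈ W n := fun m ↦ by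
      induction m with
      | zero => exact hnh
      | succ m ih => rw [Function.iterate_succ_apply']; exact hf _ ih
    have hiter : ∀ m, h - (X : k[X]) ^ m • f^[m] h ∈ S := fun m ↦ by
      induction m with
      | zero => simp
      | succ m ih =>
        have := S.add_mem ih (S.smul_mem ((X : k[X]) ^ m) (hfS _ (hmem m)))
        rw [smul_sub, smul_smul, ← pow_succ, ← Function.iterate_succ_apply' f] at this
        simpa using this
    have : Finite (W n) := hfin n
    -- All iterates lie in the finite set `W n`, so two of them coincide. Since `h` is congruent to
    -- `X ^ m • f^[m] h` modulo `S` for every `m`, the polynomial `X ^ m' - X ^ m` then carries `h`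
    -- into `S`.
    obtain ⟨m, m', hne, heq⟩ := Finite.exists_ne_map_eq_of_infinite
      fun m ↦ (⟨f^[m] h, hmem m⟩ : W n)
    have heq : f^[m] h = f^[m'] h := congrArg Subtype.val heq
    have hpoly : (X : k[X]) ^ m' - X ^ m ≠ 0 := by
      rw [sub_ne_zero]
      intro e
      have := congrArg natDegree e
      rw [natDegree_X_pow, natDegree_X_pow] at this
      exact hne this.symm
    refine ⟨⟨_, mem_nonZeroDivisors_of_ne_zero hpoly⟩, ?_⟩
    change ((X : k[X]) ^ m' - X ^ m) • Submodule.Quotient.mk h = (0 : H ⧸ S)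
    rw [← Submodule.Quotient.mk_smul, Submodule.Quotient.mk_eq_zero]
    have h1 := S.smul_mem ((X : k[X]) ^ m') (hiter m)
    have h2 := S.smul_mem ((X : k[X]) ^ m) (hiter m')
    have := S.sub_mem h1 h2
    rw [heq, smul_sub, smul_sub, smul_smul, smul_smul, mul_comm (X ^ m')] at this
    rw [sub_smul]
    simpa using this
  have hrank := rank_quotient_add_rank_of_isDomain S
  rw [htors.rank_eq_zero, zero_add] at hrank
  rw [Module.finrank, ← hrank]
  change Module.finrank k[X] S = _
  rw [finrank_span_eq_card hli, Fintype.card_fin]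

end Rank

/-! ### The kernel of the coupled additive equations -/

section Kernel

variable {F : Type*} [NormedField F]

/-- The polynomial that the first coordinates of the solutions of the homogeneous coupled
equations satisfy. -/
def eliminant (a b c d : F) : F[X] :=
  C (b ^ 2) * (C b * X ^ 4 + C a * X ^ 2 + X) ^ 4 + C (c ^ 3) * (C b * X ^ 4 + C a * X ^ 2 + X)
    + C (c ^ 4 * d ^ 2) * X ^ 4

theorem natDegree_eliminant (a : F) {b : F} (hb : b ≠ 0) (c d : F) :
    (eliminant a b c d).natDegree = 16 := by
  have h : (C b * X ^ 4 + C a * X ^ 2 + X).natDegree = 4 := by compute_degree!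
  have h16 : (C (b ^ 2) * (C b * X ^ 4 + C a * X ^ 2 + X) ^ 4).natDegree = 16 := by
    rw [natDegree_C_mul (pow_ne_zero 2 hb), natDegree_pow, h]
  rw [eliminant, add_assoc, natDegree_add_eq_left_of_natDegree_lt, h16]
  rw [h16]
  refine lt_of_le_of_lt (natDegree_add_le_of_degree_le (n := 4) ?_ ?_) (by norm_num)
  · exact (natDegree_C_mul_le _ _).trans h.le
  · exact natDegree_C_mul_X_pow_le _ _

variable [CharP F 2]

/-- In characteristic 2 only the linear term `c ^ 3 * X` survives differentiation, so the derivative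
is a nonzero constant. -/
theorem separable_eliminant (a b : F) {c : F} (hc : c ≠ 0) (d : F) :
    (eliminant a b c d).Separable := by
  have hder : derivative (eliminant a b c d) = C (c ^ 3) := by
    simp only [eliminant, derivative_add, derivative_C_mul, derivative_pow, derivative_X]
    push_cast
    have h4 : C (4 : F) = 0 := by
      rw [show (4 : F) = 2 * 2 by norm_num, CharTwo.two_eq_zero]; simp
    have h2 : C (2 : F) = 0 := by rw [CharTwo.two_eq_zero]; simp
    simp [h4, h2]
  rw [separable_def, hder]
  refine ⟨0, C (c ^ 3)⁻¹, ?_⟩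
  rw [zero_mul, zero_add, ← C_mul, inv_mul_cancel₀ (pow_ne_zero 3 hc), C_1]

variable [Algebra (ZMod 2) F]

/-- The solutions of the homogeneous coupled equations. -/
def coupledKernel (a b c d : F) : Submodule (ZMod 2) (F × F) where
  carrier := {p | b * p.1 ^ 4 + a * p.1 ^ 2 + p.1 + c * p.2 ^ 2 = 0 ∧
    b * p.2 ^ 4 + p.2 + d * p.1 ^ 2 = 0}
  add_mem' {p q} hp hq := by
    obtain ⟨h1, h2⟩ := hp
    obtain ⟨h3, h4⟩ := hq
    constructor <;> simp only [Prod.fst_add, Prod.snd_add, add_pow_four, CharTwo.add_sq]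
    · linear_combination h1 + h3
    · linear_combination h2 + h4
  zero_mem' := by simp
  smul_mem' r p hp := by
    obtain rfl | rfl : r = 0 ∨ r = 1 := by revert r; decide
    · simp
    · simpa using hp

theorem mem_coupledKernel {a b c d : F} {p : F × F} : p ∈ coupledKernel a b c d ↔
    b * p.1 ^ 4 + a * p.1 ^ 2 + p.1 + c * p.2 ^ 2 = 0 ∧ b * p.2 ^ 4 + p.2 + d * p.1 ^ 2 = 0 :=
  Iff.rfl

variable [IsAlgClosed F]

/-- The first equation determines `y ^ 2`, hence `y`, from `x`. Substituting it in `c ^ 4` times the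
square of the second gives the eliminant, so the first coordinate is a bijection onto its 16
distinct roots. -/
theorem card_coupledKernel (a : F) {b c : F} (hb : b ≠ 0) (hc : c ≠ 0) (d : F) :
    Nat.card (coupledKernel a b c d) = 16 := by
  classical
  have two : (2 : F) = 0 := CharTwo.two_eq_zero
  have heval : ∀ {x y : F}, b * x ^ 4 + a * x ^ 2 + x + c * y ^ 2 = 0 →
      (eliminant a b c d).eval x = c ^ 4 * (b * y ^ 4 + y + d * x ^ 2) ^ 2 := fun {x y} h ↦ by
    have hg : b * x ^ 4 + a * x ^ 2 + x = c * y ^ 2 := by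
      linear_combination h - c * y ^ 2 * two
    simp only [eliminant, eval_add, eval_mul, eval_pow, eval_C, eval_X, hg, CharTwo.add_sq]
    ring
  have hne : eliminant a b c d ≠ 0 := (separable_eliminant a b hc d).ne_zero
  let f : coupledKernel a b c d → ↥(eliminant a b c d).roots.toFinset := fun p ↦ ⟨p.1.1, by
    rw [Multiset.mem_toFinset, mem_roots hne, IsRoot, heval p.2.1, p.2.2]
    simp⟩
  have hf : Function.Bijective f := by
    constructor
    · rintro ⟨⟨x, y⟩, h1, h2⟩ ⟨⟨x', y'⟩, h1', h2'⟩ h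
      obtain rfl : x = x' := congrArg Subtype.val h
      have : (y + y') ^ 2 = 0 := by
        refine (mul_eq_zero.1 ?_).resolve_left hc
        simp only at h1 h1'
        rw [CharTwo.add_sq]
        linear_combination h1 + h1' - (b * x ^ 4 + a * x ^ 2 + x) * two
      obtain rfl : y = y' := CharTwo.add_eq_zero.1 (pow_eq_zero_iff two_ne_zero |>.1 this)
      rfl
    · rintro ⟨x, hx⟩
      rw [Multiset.mem_toFinset, mem_roots hne, IsRoot] at hx
      obtain ⟨y, hy⟩ := IsAlgClosed.exists_pow_nat_eq ((b * x ^ 4 + a * x ^ 2 + x) / c) two_pos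
      have h1 : b * x ^ 4 + a * x ^ 2 + x + c * y ^ 2 = 0 := by
        rw [hy, mul_div_cancel₀ _ hc]
        exact CharTwo.add_self_eq_zero _
      rw [heval h1] at hx
      have h2 := pow_eq_zero_iff two_ne_zero |>.1
        ((mul_eq_zero.1 hx).resolve_left (pow_ne_zero 4 hc))
      exact ⟨⟨(x, y), h1, h2⟩, rfl⟩
  rw [Nat.card_eq_of_bijective f hf, Nat.card_eq_fintype_card, Fintype.card_coe,
    Multiset.toFinset_card_of_nodup (nodup_roots (separable_eliminant a b hc d)),
    ← (IsAlgClosed.splits _).natDegree_eq_card_roots, natDegree_eliminant a hb c d]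

theorem finite_coupledKernel (a : F) {b c : F} (hb : b ≠ 0) (hc : c ≠ 0) (d : F) :
    Finite (coupledKernel a b c d) :=
  Nat.finite_of_card_ne_zero (by rw [card_coupledKernel a hb hc d]; norm_num)

theorem finrank_coupledKernel (a : F) {b c : F} (hb : b ≠ 0) (hc : c ≠ 0) (d : F) :
    Module.finrank (ZMod 2) (coupledKernel a b c d) = 4 := by
  have := finite_coupledKernel a hb hc d
  have h := Module.natCard_eq_pow_finrank (K := ZMod 2) (V := coupledKernel a b c d)
  rw [card_coupledKernel a hb hc d, Nat.card_zmod] at h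
  exact (Nat.pow_right_injective le_rfl (show 2 ^ 4 = 2 ^ _ from h)).symm

theorem exists_forall_mem_coupledKernel_eq_zero (a : F) {b c : F} (hb : b ≠ 0) (hc : c ≠ 0)
    (d : F) : ∃ ε > 0, ∀ p ∈ coupledKernel a b c d, ‖p.1‖ < ε → ‖p.2‖ < ε → p = 0 := by
  have := finite_coupledKernel a hb hc d
  have hfin : ((coupledKernel a b c d : Set (F × F)) \ {0}).Finite :=
    (Set.toFinite (coupledKernel a b c d : Set (F × F))).sdiff
  obtain ⟨ε, hε, h⟩ := Metric.isOpen_iff.1 hfin.isClosed.isOpen_compl 0 (by simp)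
  refine ⟨ε, hε, fun p hp h1 h2 ↦ by_contra fun hne ↦ ?_⟩
  refine h (a := p) ?_ ⟨hp, hne⟩
  rw [mem_ball_zero_iff, Prod.norm_def]
  exact max_lt h1 h2

end Kernel

/-! ### A basis of `M(A)` over `ℂ_∞[T]` -/

section SkewCoeff

variable {k : Type} [Field k] [Fintype k]

theorem coeff_mul_monomial_add (p : TauRing k) (m i : ℕ) (b : CInf k) :
    (p * SkewPolynomial.monomial m b).coeff (i + m) =
      p.coeff i * (Multiplicative.ofAdd i) • b :=
  SkewMonoidAlgebra.coeff_mul_single_aux p fun a ↦ by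
    rw [ofAdd_add, mul_left_inj]

theorem coeff_C_mul (a : CInf k) (p : TauRing k) (i : ℕ) :
    (SkewPolynomial.C a * p).coeff i = a * p.coeff i := by
  refine (SkewMonoidAlgebra.coeff_single_mul_aux p (x := 1) (z := Multiplicative.ofAdd i)
    fun a ↦ by rw [one_mul]).trans ?_
  rw [one_smul]
  rfl

theorem exists_forall_ge_coeff_eq_zero (p : TauRing k) : ∃ N, ∀ i ≥ N, p.coeff i = 0 := by
  refine ⟨p.support.sup id + 1, fun i hi ↦ ?_⟩
  rw [← SkewPolynomial.notMem_support_iff]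
  intro h
  have := Finset.le_sup (f := id) h
  simp only [id] at this
  omega

end SkewCoeff

section MotiveBasis

variable {k : Type} [Field k] [Fintype k] {n : ℕ} (A : Matrix (Fin n) (Fin n) (CInf k))

theorem coeff_mulT_add_two (m : Motive A) (l : Fin n) (i : ℕ) :
    (mulT A m l).coeff (i + 2) = (m l).coeff (i + 2) * (Multiplicative.ofAdd (i + 2)) • theta k
      + ∑ j, (m j).coeff (i + 1) * (Multiplicative.ofAdd (i + 1)) • A j l + (m l).coeff i := by
  have hsum : ∀ f : Fin n → TauRing k, (∑ j, f j).coeff (i + 2) = ∑ j, (f j).coeff (i + 2) :=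
    fun f ↦ map_sum (⟨⟨fun p : TauRing k ↦ p.coeff (i + 2), rfl⟩,
      fun p q ↦ SkewPolynomial.coeff_add p q _⟩ : TauRing k →+ CInf k) f _
  have h : mulT A m l = ∑ j, m j * motiveMatrix A j l := rfl
  rw [h, hsum]
  have hterm : ∀ j, (m j * motiveMatrix A j l).coeff (i + 2) =
      (if j = l then (m j).coeff (i + 2) * (Multiplicative.ofAdd (i + 2)) • theta k else 0)
      + (m j).coeff (i + 1) * (Multiplicative.ofAdd (i + 1)) • A j l
      + (if j = l then (m j).coeff i else 0) := by
    intro j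
    have h1 := coeff_mul_monomial_add (m j) 1 (i + 1) (A j l)
    have h2 := coeff_mul_monomial_add (m j) 2 i 1
    have h0 := coeff_mul_monomial_add (m j) 0 (i + 2) (theta k)
    rw [smul_one, mul_one, SkewPolynomial.monomial_one_right_eq_X_pow] at h2
    rw [← SkewPolynomial.C_mul_X_eq_monomial] at h1
    rw [SkewPolynomial.monomial_zero_left] at h0
    simp only [motiveMatrix, Matrix.add_apply, Matrix.map_apply, Matrix.diagonal_apply, mul_add,
      SkewPolynomial.coeff_add]
    split_ifs with hjl
    · rw [h2]
      exact congrArg₂ (· + ·) (congrArg₂ (· + ·) h0 h1) rfl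
    · rw [mul_zero, SkewPolynomial.coeff_zero]
      exact congrArg₂ (· + ·) (congrArg₂ (· + ·) rfl h1) rfl
  simp only [hterm, Finset.sum_add_distrib, Finset.sum_ite_eq', Finset.mem_univ, if_true]

/-- Multiplication by `T` raises the degree in τ by exactly 2, as τ² has coefficient 1. The
coefficients of `m` vanish from the top down; `d` measures the distance to a common bound. -/
theorem eq_zero_of_coeff_mulT_add_two {m : Motive A}
    (h : ∀ l i, (mulT A m l).coeff (i + 2) = 0) : m = 0 := by
  choose N hN using fun l ↦ exists_forall_ge_coeff_eq_zero (m l)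
  have key : ∀ d i, ∑ l, N l ≤ i + d → ∀ l, (m l).coeff i = 0 := by
    intro d
    induction d with
    | zero =>
      intro i hi l
      exact hN l i ((Finset.single_le_sum (f := N) (fun _ _ ↦ Nat.zero_le _)
        (Finset.mem_univ l)).trans hi)
    | succ d ih =>
      intro i hi l
      have := h l i
      rw [coeff_mulT_add_two, ih (i + 2) (by omega), zero_mul, zero_add,
        Finset.sum_eq_zero fun j _ ↦ by rw [ih (i + 1) (by omega), zero_mul], zero_add] at this
      exact this
  funext l
  exact SkewPolynomial.ext fun i ↦ key _ i (Nat.le_add_left _ _) l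

/-- The vectors `e_1, …, e_n, τ e_1, …, τ e_n`. -/
def basisVec : Fin n ⊕ Fin n → OverPoly k (Motive A) :=
  Sum.elim (fun j ↦ Motive.e A j) (fun j ↦ tau k • Motive.e A j)

theorem C_smul_overPoly (a : CInf k) (m : OverPoly k (Motive A)) :
    (C a : (CInf k)[X]) • m = const k a • m := by
  rw [poly_smul_def]
  simp [ofPoly, const]

theorem X_smul_overPoly (m : OverPoly k (Motive A)) :
    (X : (CInf k)[X]) • m = (X : AndersonRing k) • m := by
  rw [poly_smul_def]
  simp [ofPoly]

/-- The action of `τ` on the second half of the basis. -/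
theorem tau_smul_basisVec_inr (j : Fin n) : tau k • basisVec A (Sum.inr j) =
    ((X - C (theta k) : (CInf k)[X])) • basisVec A (Sum.inl j)
      - ∑ l, (C (A j l) : (CInf k)[X]) • basisVec A (Sum.inr l) := by
  have h : (X : AndersonRing k) • basisVec A (Sum.inl j) =
      const k (theta k) • basisVec A (Sum.inl j)
        + ∑ l, const k (A j l) • basisVec A (Sum.inr l) + tau k • basisVec A (Sum.inr j) := by
    refine (T_smul_e A j).trans ?_
    rw [pow_two, mul_smul]
    rfl
  rw [sub_smul, X_smul_overPoly, h]
  simp only [C_smul_overPoly]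
  abel

/-- The equation for `T e_j` expresses `τ² e_j` through the basis, so the span is τ-stable and
contains every `τ ^ i e_j`. -/
theorem span_basisVec : ⊤ ≤ Submodule.span (CInf k)[X] (Set.range (basisVec A)) := by
  set S := Submodule.span (CInf k)[X] (Set.range (basisVec A)) with hS
  have hmem : ∀ i, basisVec A i ∈ S := fun i ↦ Submodule.subset_span ⟨i, rfl⟩
  have htau : ∀ m ∈ S, tau k • m ∈ S := by
    intro m hm
    induction hm using Submodule.span_induction with
    | mem m hm =>
      obtain ⟨i | i, rfl⟩ := hm
      · exact hmem (Sum.inr i)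
      · rw [tau_smul_basisVec_inr]
        exact S.sub_mem (S.smul_mem _ (hmem _)) (S.sum_mem fun l _ ↦ S.smul_mem _ (hmem _))
    | zero => rw [smul_zero]; exact S.zero_mem
    | add x y _ _ hx hy => rw [smul_add]; exact S.add_mem hx hy
    | smul f x _ hx =>
      have : tau k • f • x = polyFrob k f • tau k • x := (tauₛₗ k (Motive A)).map_smulₛₗ f x
      rw [this]
      exact S.smul_mem _ hx
  have hpow : ∀ i j, tau k ^ i • basisVec A (Sum.inl j) ∈ S := fun i j ↦ by
    induction i with
    | zero => rw [pow_zero, one_smul]; exact hmem _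
    | succ i ih => rw [pow_succ', mul_smul]; exact htau _ ih
  have hmono : ∀ (p : TauRing k) j, (C p : AndersonRing k) • basisVec A (Sum.inl j) ∈ S := by
    intro p j
    induction p using SkewPolynomial.induction with
    | h0 => rw [C_0, zero_smul]; exact S.zero_mem
    | ha i r q _ _ hq =>
      rw [C_add, add_smul]
      refine S.add_mem ?_ hq
      have : (C (SkewPolynomial.monomial i r) : AndersonRing k) = const k r * tau k ^ i := by
        rw [← SkewPolynomial.C_mul_X_pow_eq_monomial, C_mul, C_pow]
        rfl
      rw [this, mul_smul, ← C_smul_overPoly]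
      exact S.smul_mem _ (hpow i j)
  intro m _
  have hm : m = ∑ j, (C (m j) : AndersonRing k) • basisVec A (Sum.inl j) := by
    have : ∀ j, (C (m j) : AndersonRing k) • basisVec A (Sum.inl j) =
        (Pi.single j (m j) : Fin n → TauRing k) := fun j ↦ by
      refine (C_smul A (m j) (Motive.e A j)).trans ?_
      funext l
      change m j * Pi.single (M := fun _ ↦ TauRing k) j 1 l = _
      by_cases hl : l = j
      · subst hl; simp
      · simp [hl]
    simp only [this]
    exact (Finset.univ_sum_single (m : Fin n → TauRing k)).symm
  rw [hm]
  exact S.sum_mem fun j _ ↦ hmono _ j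

/-- The coefficient of `τ ^ i e_l`. -/
def tauCoeff (l : Fin n) (i : ℕ) : OverPoly k (Motive A) →+ CInf k where
  toFun m := SkewPolynomial.coeff ((show Fin n → TauRing k from m) l) i
  map_zero' := rfl
  map_add' _ _ := SkewPolynomial.coeff_add _ _ _

theorem tauCoeff_C_smul_basisVec (a : CInf k) (s : Fin n ⊕ Fin n) (l : Fin n) (i : ℕ) :
    tauCoeff A l i ((C a : (CInf k)[X]) • basisVec A s) =
      if s = if i = 0 then Sum.inl l else Sum.inr l then (if i ≤ 1 then a else 0) else 0 := by
  have h : ∀ m : OverPoly k (Motive A),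
      tauCoeff A l i ((C a : (CInf k)[X]) • m) = a * tauCoeff A l i m := fun m ↦ by
    rw [C_smul_overPoly]
    refine Eq.trans ?_ (coeff_C_mul a ((show Fin n → TauRing k from m) l) i)
    exact congrArg (SkewPolynomial.coeff · i) (congrFun (C_smul A (SkewPolynomial.C a) m) l)
  rw [h]
  rcases s with j | j
  · have h1 : tauCoeff A l i (basisVec A (Sum.inl j)) =
        SkewPolynomial.coeff (if l = j then (1 : TauRing k) else 0) i :=
      congrArg (SkewPolynomial.coeff · i) (Pi.single_apply j (1 : TauRing k) l)
    rw [h1]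
    rcases i with _ | i <;> by_cases hl : l = j <;>
      simp [hl, SkewPolynomial.coeff_one, eq_comm (a := j)]
  · have h1 : tauCoeff A l i (basisVec A (Sum.inr j)) =
        SkewPolynomial.coeff (if l = j then (SkewPolynomial.X : TauRing k) else 0) i := by
      refine congrArg (SkewPolynomial.coeff · i) ?_
      refine (congrFun (C_smul A SkewPolynomial.X (Motive.e A j)) l).trans ?_
      refine (congrArg (fun t : TauRing k ↦ (SkewPolynomial.X : TauRing k) * t)
        (Pi.single_apply j (1 : TauRing k) l)).trans ?_
      split_ifs <;> simp
    rw [h1]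
    rcases i with _ | _ | i <;> by_cases hl : l = j <;>
      simp [hl, SkewPolynomial.coeff_X, eq_comm (a := j)]

/-- A relation reads `T m = -m₀`, where `m₀` collects the constant terms and has degree at most 1 in
τ. As `T` raises that degree by 2, both `m` and `m₀` vanish, and `m = 0` is a relation of lower
degree in `T`. -/
theorem linearIndependent_basisVec : LinearIndependent (CInf k)[X] (basisVec A) := by
  have key : ∀ (N : ℕ) (p : Fin n ⊕ Fin n → (CInf k)[X]), (∀ s, ∀ i ≥ N, (p s).coeff i = 0) →
      ∑ s, p s • basisVec A s = 0 → ∀ s, p s = 0 := by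
    intro N
    induction N with
    | zero => exact fun p hp _ s ↦ Polynomial.ext fun i ↦ hp s i (Nat.zero_le i)
    | succ N ih =>
      intro p hp h
      let m : OverPoly k (Motive A) := ∑ s, (p s).divX • basisVec A s
      let m₀ : OverPoly k (Motive A) := ∑ s, C ((p s).coeff 0) • basisVec A s
      have hsplit : (X : (CInf k)[X]) • m + m₀ = 0 := by
        rw [← h, Finset.smul_sum, ← Finset.sum_add_distrib]
        refine Finset.sum_congr rfl fun s _ ↦ ?_
        rw [smul_smul, ← add_smul, X_mul, divX_mul_X_add]
      have hm₀ : ∀ l i, tauCoeff A l i m₀ =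
          if i ≤ 1 then (p (if i = 0 then Sum.inl l else Sum.inr l)).coeff 0 else 0 := by
        intro l i
        rw [map_sum]
        simp only [tauCoeff_C_smul_basisVec, Finset.sum_ite_eq', Finset.mem_univ, if_true]
      have hX : mulT A m = -m₀ :=
        (T_smul A m).symm.trans
          ((X_smul_overPoly A m).symm.trans (eq_neg_of_add_eq_zero_left hsplit))
      have hm : m = 0 := by
        refine eq_zero_of_coeff_mulT_add_two A fun l i ↦ ?_
        rw [hX]
        refine (map_neg (tauCoeff A l (i + 2)) m₀).trans ?_
        rw [hm₀, if_neg (by omega), neg_zero]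
      have hdiv := ih (fun s ↦ (p s).divX) (fun s i hi ↦ by
        rw [coeff_divX]; exact hp s (i + 1) (by omega)) hm
      have hm₀0 : m₀ = 0 := by
        rw [hm, smul_zero, zero_add] at hsplit
        exact hsplit
      have hcoeff : ∀ s, (p s).coeff 0 = 0 := by
        rintro (l | l)
        · have := hm₀ l 0
          rw [hm₀0, map_zero] at this
          exact this.symm
        · have := hm₀ l 1
          rw [hm₀0, map_zero] at this
          exact this.symm
      intro s
      rw [← divX_mul_X_add (p s), hdiv s, hcoeff s]
      simp
  refine Fintype.linearIndependent_iff.2 fun p hp ↦ ?_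
  refine key (∑ s, ((p s).natDegree + 1)) p (fun s i hi ↦ ?_) hp
  refine coeff_eq_zero_of_natDegree_lt ?_
  have := Finset.single_le_sum (f := fun s ↦ (p s).natDegree + 1) (fun _ _ ↦ Nat.zero_le _)
    (Finset.mem_univ s)
  omega

/-- The basis `e_1, …, e_n, τ e_1, …, τ e_n` of `M(A)` over `ℂ_∞[T]`. -/
def motiveBasis : Module.Basis (Fin n ⊕ Fin n) (CInf k)[X] (OverPoly k (Motive A)) :=
  Module.Basis.mk (linearIndependent_basisVec A) (span_basisVec A)

theorem motiveBasis_apply (s : Fin n ⊕ Fin n) : motiveBasis A s = basisVec A s :=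
  Module.Basis.mk_apply _ _ s

end MotiveBasis

/-! ### Coordinates on `M(A){T}` -/

section Coordinates

variable {k : Type} [Field k] [Fintype k] {n : ℕ} (A : Matrix (Fin n) (Fin n) (CInf k))

/-- The coordinates of the elements of `M(A){T}` in the basis `e_1, …, e_n, τ e_1, …, τ e_n`. -/
def tateCoords : TateModule k (Motive A) ≃ₗ[(CInf k)[X]] (Fin n ⊕ Fin n →₀ Tate k) :=
  Algebra.TensorProduct.basisAux (Tate k) (motiveBasis A)

/-- The pure tensors of `M{T}`, as a map that is linear in the second variable. -/
def tateTmul (M : Type) [AddCommGroup M] [Module (AndersonRing k) M] (r : Tate k) :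
    OverPoly k M →ₗ[(CInf k)[X]] TateModule k M :=
  TensorProduct.mk (CInf k)[X] (Tate k) (OverPoly k M) r

theorem tateCoords_tateTmul (r : Tate k) (s : Fin n ⊕ Fin n) :
    tateCoords A (tateTmul (Motive A) r (basisVec A s)) = Finsupp.single s r := by
  refine (Algebra.TensorProduct.basisAux_tmul (motiveBasis A) r (basisVec A s)).trans ?_
  rw [← motiveBasis_apply, Module.Basis.repr_self]
  ext t : 1
  simp [Finsupp.single_apply]

theorem smul_tate_def (f : (CInf k)[X]) (r : Tate k) : f • r = polyToTate k f * r := rfl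

theorem tauTate_tateTmul (r : Tate k) (m : OverPoly k (Motive A)) :
    tauTate k (Motive A) (tateTmul (Motive A) r m) =
      tateTmul (Motive A) (tateFrob k r) (tau k • m) :=
  rfl

theorem eq_sum_tateTmul (x : TateModule k (Motive A)) :
    x = ∑ s, tateTmul (Motive A) (tateCoords A x s) (basisVec A s) := by
  apply (tateCoords A).injective
  rw [map_sum]
  simp only [tateCoords_tateTmul]
  exact (Finsupp.univ_sum_single _).symm

theorem tateCoords_tauTate (x : TateModule k (Motive A)) :
    tateCoords A (tauTate k (Motive A) x) =
      ∑ j, Finsupp.single (Sum.inr j) (tateFrob k (tateCoords A x (Sum.inl j)))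
      + ∑ j, ((X - C (theta k) : (CInf k)[X]) •
          Finsupp.single (Sum.inl j) (tateFrob k (tateCoords A x (Sum.inr j)))
        - ∑ l, (C (A j l) : (CInf k)[X]) •
          Finsupp.single (Sum.inr l) (tateFrob k (tateCoords A x (Sum.inr j)))) := by
  conv_lhs => rw [eq_sum_tateTmul A x]
  rw [map_sum, map_sum, Fintype.sum_sum_type]
  simp only [tauTate_tateTmul]
  congr 1
  · exact Finset.sum_congr rfl fun j _ ↦ tateCoords_tateTmul A _ (Sum.inr j)
  · refine Finset.sum_congr rfl fun j _ ↦ ?_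
    rw [tau_smul_basisVec_inr]
    simp only [map_sub, map_sum, map_smul, tateCoords_tateTmul]

/-- Comparing coordinates shows that those along `e_j` are determined by those along `τ e_j`, so
only the latter are kept as unknowns. -/
theorem mem_H1_iff (x : TateModule k (Motive A)) : x ∈ H1 k (Motive A) ↔
    (∀ j, tateCoords A x (Sum.inl j) =
      polyToTate k (X - C (theta k)) * tateFrob k (tateCoords A x (Sum.inr j))) ∧
    ∀ l, tateCoords A x (Sum.inr l) = tateFrob k (tateCoords A x (Sum.inl l))
      - ∑ j, polyToTate k (C (A j l)) * tateFrob k (tateCoords A x (Sum.inr j)) := by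
  have h : x ∈ H1 k (Motive A) ↔ tauTate k (Motive A) x = x := Iff.rfl
  rw [h, ← (tateCoords A).injective.eq_iff, tateCoords_tauTate, Finsupp.ext_iff, Sum.forall]
  simp only [Finsupp.add_apply, Finsupp.sub_apply, Finsupp.finsetSum_apply, Finsupp.smul_apply,
    Finsupp.single_apply, smul_tate_def]
  refine and_congr (forall_congr' fun j ↦ ?_) (forall_congr' fun l ↦ ?_)
  · simp [eq_comm]
  · simp [sub_eq_add_neg, eq_comm]

end Coordinates

/-! ### `τ`-stable elements as solutions of a recursion -/

section Recursion

open Filter Topology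

variable {k : Type} [Field k] [Fintype k]

theorem coeff_tateFrob (f : Tate k) (i : ℕ) :
    PowerSeries.coeff i (tateFrob k f : PowerSeries (CInf k)) =
      PowerSeries.coeff i (f : PowerSeries (CInf k)) ^ Fintype.card k :=
  rfl

theorem coeff_polyToTate_C_mul (a : CInf k) (f : Tate k) (i : ℕ) :
    PowerSeries.coeff i (polyToTate k (C a) * f : PowerSeries (CInf k)) =
      a * PowerSeries.coeff i (f : PowerSeries (CInf k)) := by
  have h : (polyToTate k (C a) : PowerSeries (CInf k)) = PowerSeries.C a := coe_C a
  rw [h, PowerSeries.coeff_C_mul]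

theorem coe_polyToTate_X_sub_C (a : CInf k) :
    (polyToTate k (X - C a) : PowerSeries (CInf k)) = PowerSeries.X - PowerSeries.C a := by
  have h : (polyToTate k (X - C a) : PowerSeries (CInf k)) =
    (((X - C a : (CInf k)[X])) : PowerSeries (CInf k)) := rfl
  rw [h, coe_sub, coe_X, coe_C]

theorem coeff_zero_polyToTate_X_sub_C_mul (a : CInf k) (f : Tate k) :
    PowerSeries.coeff 0 (polyToTate k (X - C a) * f : PowerSeries (CInf k)) =
      -(a * PowerSeries.coeff 0 (f : PowerSeries (CInf k))) := by
  rw [coe_polyToTate_X_sub_C, sub_mul, map_sub, PowerSeries.coeff_C_mul,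
    PowerSeries.coeff_zero_X_mul, zero_sub]

theorem coeff_succ_polyToTate_X_sub_C_mul (a : CInf k) (f : Tate k) (i : ℕ) :
    PowerSeries.coeff (i + 1) (polyToTate k (X - C a) * f : PowerSeries (CInf k)) =
      PowerSeries.coeff i (f : PowerSeries (CInf k))
        - a * PowerSeries.coeff (i + 1) (f : PowerSeries (CInf k)) := by
  rw [coe_polyToTate_X_sub_C, sub_mul, map_sub, PowerSeries.coeff_C_mul,
    PowerSeries.coeff_succ_X_mul]

variable {n : ℕ} (A : Matrix (Fin n) (Fin n) (CInf k))

/-- The coefficient of `T ^ i τ e_l`. -/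
def seriesCoeff (l : Fin n) (i : ℕ) : TateModule k (Motive A) →+ CInf k where
  toFun x := PowerSeries.coeff i (tateCoords A x (Sum.inr l) : PowerSeries (CInf k))
  map_zero' := by simp
  map_add' x y := by simp

theorem tendsto_seriesCoeff (l : Fin n) (x : TateModule k (Motive A)) :
    Tendsto (fun i ↦ seriesCoeff A l i x) atTop (𝓝 0) :=
  (mem_tate k).1 (tateCoords A x (Sum.inr l)).2

/-- The recursion that the coefficients of a `τ`-stable element satisfy. -/
def IsRecursive (c : Fin n → ℕ → CInf k) : Prop :=
  (∀ l, c l 0 = -(theta k * c l 0 ^ Fintype.card k) ^ Fintype.card k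
      - ∑ j, A j l * c j 0 ^ Fintype.card k) ∧
    ∀ l i, c l (i + 1) =
      (c l i ^ Fintype.card k - theta k * c l (i + 1) ^ Fintype.card k) ^ Fintype.card k
      - ∑ j, A j l * c j (i + 1) ^ Fintype.card k

theorem neg_pow_card (x : CInf k) : (-x) ^ Fintype.card k = -x ^ Fintype.card k := by
  rw [← frob_apply, map_neg, frob_apply]

theorem series_eq_iff_isRecursive (z : Fin n → Tate k) :
    (∀ l, z l = tateFrob k (polyToTate k (X - C (theta k)) * tateFrob k (z l))
      - ∑ j, polyToTate k (C (A j l)) * tateFrob k (z j)) ↔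
    IsRecursive A fun l i ↦ PowerSeries.coeff i (z l : PowerSeries (CInf k)) := by
  have hsum : ∀ l i, PowerSeries.coeff i
      ((∑ j, polyToTate k (C (A j l)) * tateFrob k (z j) : Tate k) : PowerSeries (CInf k)) =
        ∑ j, A j l * PowerSeries.coeff i (z j : PowerSeries (CInf k)) ^ Fintype.card k := by
    intro l i
    rw [AddSubmonoidClass.coe_finsetSum, map_sum]
    exact Finset.sum_congr rfl fun j _ ↦ by
      rw [Subring.coe_mul, coeff_polyToTate_C_mul, coeff_tateFrob]
  rw [IsRecursive, ← forall_and]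
  refine forall_congr' fun l ↦ ?_
  rw [Subtype.ext_iff, PowerSeries.ext_iff]
  have h0 : PowerSeries.coeff 0 ((tateFrob k (polyToTate k (X - C (theta k)) * tateFrob k (z l))
      - ∑ j, polyToTate k (C (A j l)) * tateFrob k (z j) : Tate k) : PowerSeries (CInf k)) =
      -(theta k * PowerSeries.coeff 0 (z l : PowerSeries (CInf k)) ^ Fintype.card k)
          ^ Fintype.card k
        - ∑ j, A j l * PowerSeries.coeff 0 (z j : PowerSeries (CInf k)) ^ Fintype.card k := by
    rw [AddSubgroupClass.coe_sub, map_sub, hsum, coeff_tateFrob, Subring.coe_mul,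
      coeff_zero_polyToTate_X_sub_C_mul, coeff_tateFrob, neg_pow_card]
  have h1 : ∀ i, PowerSeries.coeff (i + 1)
      ((tateFrob k (polyToTate k (X - C (theta k)) * tateFrob k (z l))
      - ∑ j, polyToTate k (C (A j l)) * tateFrob k (z j) : Tate k) : PowerSeries (CInf k)) =
      (PowerSeries.coeff i (z l : PowerSeries (CInf k)) ^ Fintype.card k
        - theta k * PowerSeries.coeff (i + 1) (z l : PowerSeries (CInf k)) ^ Fintype.card k)
          ^ Fintype.card k
        - ∑ j, A j l * PowerSeries.coeff (i + 1) (z j : PowerSeries (CInf k)) ^ Fintype.card k := by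
    intro i
    rw [AddSubgroupClass.coe_sub, map_sub, hsum, coeff_tateFrob, Subring.coe_mul,
      coeff_succ_polyToTate_X_sub_C_mul, coeff_tateFrob, coeff_tateFrob]
  constructor
  · exact fun h ↦ ⟨(h 0).trans h0, fun i ↦ (h (i + 1)).trans (h1 i)⟩
  · rintro ⟨h, h'⟩ (_ | i)
    · exact h.trans h0.symm
    · exact (h' i).trans (h1 i).symm

theorem isRecursive_seriesCoeff {x : TateModule k (Motive A)} (hx : x ∈ H1 k (Motive A)) :
    IsRecursive A fun l i ↦ seriesCoeff A l i x := by
  obtain ⟨h1, h2⟩ := (mem_H1_iff A x).1 hx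
  refine (series_eq_iff_isRecursive A fun l ↦ tateCoords A x (Sum.inr l)).1 fun l ↦ ?_
  rw [← h1]
  exact h2 l

theorem exists_mem_H1_seriesCoeff_eq {c : Fin n → ℕ → CInf k} (hc : IsRecursive A c)
    (h0 : ∀ l, Tendsto (c l) atTop (𝓝 0)) :
    ∃ x ∈ H1 k (Motive A), ∀ l i, seriesCoeff A l i x = c l i := by
  let z : Fin n → Tate k := fun l ↦ ⟨PowerSeries.mk (c l), by
    rw [mem_tate]
    simpa only [PowerSeries.coeff_mk] using h0 l⟩
  have hz : ∀ l i, PowerSeries.coeff i (z l : PowerSeries (CInf k)) = c l i :=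
    fun l i ↦ PowerSeries.coeff_mk i (c l)
  let r : Fin n ⊕ Fin n →₀ Tate k := Finsupp.equivFunOnFinite.symm
    (Sum.elim (fun l ↦ polyToTate k (X - C (theta k)) * tateFrob k (z l)) z)
  have hr : tateCoords A ((tateCoords A).symm r) = r := (tateCoords A).apply_symm_apply r
  refine ⟨(tateCoords A).symm r, ?_, fun l i ↦ ?_⟩
  · rw [mem_H1_iff, hr]
    refine ⟨fun j ↦ rfl, ?_⟩
    refine (series_eq_iff_isRecursive A z).2 ?_
    simpa only [hz] using hc
  · change PowerSeries.coeff i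
      (tateCoords A ((tateCoords A).symm r) (Sum.inr l) : PowerSeries (CInf k)) = _
    rw [hr]
    exact hz l i

theorem eq_zero_of_seriesCoeff_eq_zero {x : TateModule k (Motive A)} (hx : x ∈ H1 k (Motive A))
    (h : ∀ l i, seriesCoeff A l i x = 0) : x = 0 := by
  have hr : ∀ l, tateCoords A x (Sum.inr l) = 0 := fun l ↦
    Subtype.ext (PowerSeries.ext fun i ↦ h l i)
  apply (tateCoords A).injective
  rw [map_zero]
  ext1 s
  obtain l | l := s
  · rw [((mem_H1_iff A x).1 hx).1 l, hr, map_zero, mul_zero]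
    rfl
  · exact hr l

theorem tateCoords_smul (p : k[X]) (x : TateModule k (Motive A)) (l : Fin n) :
    (tateCoords A (p • x) (Sum.inr l) : PowerSeries (CInf k)) =
      (p.map (algebraMap k (CInf k)) : (CInf k)[X]) * (tateCoords A x (Sum.inr l)) := by
  rw [smul_tateModule_def, map_smul, Finsupp.smul_apply, smul_tate_def]
  rfl

theorem seriesCoeff_zero_smul (p : k[X]) (x : TateModule k (Motive A)) (l : Fin n) :
    seriesCoeff A l 0 (p • x) = algebraMap k (CInf k) (p.coeff 0) * seriesCoeff A l 0 x := by
  change PowerSeries.coeff 0 (tateCoords A (p • x) (Sum.inr l) : PowerSeries (CInf k)) = _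
  rw [tateCoords_smul, PowerSeries.coeff_mul, Finset.Nat.antidiagonal_zero, Finset.sum_singleton,
    coeff_coe, coeff_map]
  rfl

theorem seriesCoeff_succ_X_smul (x : TateModule k (Motive A)) (l : Fin n) (i : ℕ) :
    seriesCoeff A l (i + 1) ((X : k[X]) • x) = seriesCoeff A l i x := by
  change PowerSeries.coeff (i + 1)
    (tateCoords A ((X : k[X]) • x) (Sum.inr l) : PowerSeries (CInf k)) = _
  rw [tateCoords_smul, map_X, coe_X, PowerSeries.coeff_succ_X_mul]
  rfl

end Recursion

/-! ### The rank of the cohomology -/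

section Cohomology

open Filter Topology

variable {a₁₁ a₁₂ a₂₁ : CInf (ZMod 2)}

/-- Squaring is additive, so `θ` enters as `θ ^ 2`. The matrix acts through its transpose, so `a₂₁`
multiplies the second unknown in the first equation and `a₁₂` the first unknown in the second. -/
theorem isRecursive_iff (c : Fin 2 → ℕ → CInf (ZMod 2)) :
    IsRecursive !![a₁₁, a₁₂; a₂₁, 0] c ↔
      (c 0 0, c 1 0) ∈ coupledKernel a₁₁ (theta (ZMod 2) ^ 2) a₂₁ a₁₂ ∧
      ∀ i, theta (ZMod 2) ^ 2 * c 0 (i + 1) ^ 4 + a₁₁ * c 0 (i + 1) ^ 2 + c 0 (i + 1)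
          + a₂₁ * c 1 (i + 1) ^ 2 = c 0 i ^ 4 ∧
        theta (ZMod 2) ^ 2 * c 1 (i + 1) ^ 4 + c 1 (i + 1) + a₁₂ * c 0 (i + 1) ^ 2 = c 1 i ^ 4 := by
  have two : (2 : CInf (ZMod 2)) = 0 := CharTwo.two_eq_zero
  set θ := theta (ZMod 2) with hθ
  simp only [IsRecursive, mem_coupledKernel, ZMod.card, Fin.forall_fin_two, Fin.sum_univ_two,
    Matrix.of_apply, Matrix.cons_val', Matrix.cons_val_zero, Matrix.cons_val_one,
    Matrix.cons_val_fin_one, forall_and, ← hθ]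
  refine and_congr (and_congr ?_ ?_)
    (and_congr (forall_congr' fun i ↦ ?_) (forall_congr' fun i ↦ ?_))
  · constructor <;> intro h <;> linear_combination h
  · constructor <;> intro h <;> linear_combination h
  · constructor <;> intro h
    · linear_combination h + (θ ^ 2 * c 0 (i + 1) ^ 4 - θ * c 0 i ^ 2 * c 0 (i + 1) ^ 2) * two
    · linear_combination h - (θ ^ 2 * c 0 (i + 1) ^ 4 - θ * c 0 i ^ 2 * c 0 (i + 1) ^ 2) * two
  · constructor <;> intro h
    · linear_combination h + (θ ^ 2 * c 1 (i + 1) ^ 4 - θ * c 1 i ^ 2 * c 1 (i + 1) ^ 2) * two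
    · linear_combination h - (θ ^ 2 * c 1 (i + 1) ^ 4 - θ * c 1 i ^ 2 * c 1 (i + 1) ^ 2) * two

/-- The cohomology has full rank as soon as the product `a₁₂ a₂₁ ^ 2` is smaller than `θ ^ 2`. -/
theorem h1_eq_four_of_norm_lt (h₂₁ : a₂₁ ≠ 0)
    (h : ‖a₁₂‖ * ‖a₂₁‖ ^ 2 < ‖theta (ZMod 2) ^ 2‖) :
    h1 (ZMod 2) (Motive !![a₁₁, a₁₂; a₂₁, 0]) = 4 := by
  set A : Matrix (Fin 2) (Fin 2) (CInf (ZMod 2)) := !![a₁₁, a₁₂; a₂₁, 0]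
  set b := theta (ZMod 2) ^ 2 with hb
  have hb1 : 1 < ‖b‖ := by
    rw [hb, norm_pow]
    exact one_lt_pow₀ (one_lt_norm_theta _) two_ne_zero
  have hb0 : b ≠ 0 := norm_pos_iff.1 (one_pos.trans hb1)
  have hrec : ∀ x ∈ H1 (ZMod 2) (Motive A), _ := fun x hx ↦
    (isRecursive_iff _).1 (isRecursive_seriesCoeff A hx)
  have hlift : ∀ x y : ℕ → CInf (ZMod 2), (x 0, y 0) ∈ coupledKernel a₁₁ b a₂₁ a₁₂ →
      (∀ i, b * x (i + 1) ^ 4 + a₁₁ * x (i + 1) ^ 2 + x (i + 1) + a₂₁ * y (i + 1) ^ 2 = x i ^ 4 ∧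
        b * y (i + 1) ^ 4 + y (i + 1) + a₁₂ * x (i + 1) ^ 2 = y i ^ 4) →
      Tendsto x atTop (𝓝 0) → Tendsto y atTop (𝓝 0) →
      ∃ z ∈ H1 (ZMod 2) (Motive A), ∀ i, seriesCoeff A 0 i z = x i ∧ seriesCoeff A 1 i z = y i := by
    intro x y h0 hi hx hy
    obtain ⟨z, hz, hzc⟩ := exists_mem_H1_seriesCoeff_eq A (c := ![x, y])
      ((isRecursive_iff _).2 ⟨h0, hi⟩) (Fin.forall_fin_two.2 ⟨hx, hy⟩)
    exact ⟨z, hz, fun i ↦ ⟨hzc 0 i, hzc 1 i⟩⟩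
  have := finite_coupledKernel a₁₁ hb0 h₂₁ a₁₂
  obtain ⟨δ, hδ, hsmall⟩ := exists_forall_mem_coupledKernel_eq_zero a₁₁ hb0 h₂₁ a₁₂
  let ε : H1 (ZMod 2) (Motive A) →+ coupledKernel a₁₁ b a₂₁ a₁₂ :=
    { toFun := fun x ↦ ⟨(seriesCoeff A 0 0 x, seriesCoeff A 1 0 x), (hrec x x.2).1⟩
      map_zero' := by ext <;> simp
      map_add' := fun x y ↦ by ext <;> simp }
  have hε0 : ∀ x, ε x = 0 ↔ seriesCoeff A 0 0 x.1 = 0 ∧ seriesCoeff A 1 0 x.1 = 0 := fun x ↦ by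
    rw [Subtype.ext_iff, Prod.ext_iff]
    rfl
  let W : ℕ → AddSubgroup (H1 (ZMod 2) (Motive A)) := fun n ↦
    { carrier := {x | ∀ i ≥ n, ∀ l, ‖seriesCoeff A l i x‖ < δ}
      zero_mem' := fun i _ l ↦ by simpa using hδ
      add_mem' := fun {x y} hx hy i hi l ↦ by
        rw [Submodule.coe_add, map_add]
        exact (IsUltrametricDist.norm_add_le_max _ _).trans_lt (max_lt (hx i hi l) (hy i hi l))
      neg_mem' := fun {x} hx i hi l ↦ by
        rw [Submodule.coe_neg, map_neg, norm_neg]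
        exact hx i hi l }
  have hext : ∀ x : H1 (ZMod 2) (Motive A), (∀ i, seriesCoeff A 0 i x.1 = 0) →
      (∀ i, seriesCoeff A 1 i x.1 = 0) → x = 0 := fun x h0 h1 ↦
    Subtype.ext (eq_zero_of_seriesCoeff_eq_zero A x.2 (Fin.forall_fin_two.2 ⟨h0, h1⟩))
  have hX : ∀ (x : H1 (ZMod 2) (Motive A)) l i,
      seriesCoeff A l (i + 1) ((X : (ZMod 2)[X]) • x).1 = seriesCoeff A l i x.1 :=
    fun x l i ↦ seriesCoeff_succ_X_smul A x.1 l i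
  have hX0 : ∀ (x : H1 (ZMod 2) (Motive A)) l,
      seriesCoeff A l 0 ((X : (ZMod 2)[X]) • x).1 = 0 := fun x l ↦ by
    refine (seriesCoeff_zero_smul A X x.1 l).trans ?_
    rw [coeff_X_zero, map_zero, zero_mul]
  refine (finrank_eq_of_filtration ε W ?_ ?_ ?_ ?_ ?_ ?_ ?_ ?_ ?_).trans
    (finrank_coupledKernel a₁₁ hb0 h₂₁ a₁₂)
  · intro p x
    refine Subtype.ext (Prod.ext ?_ ?_)
    · refine (seriesCoeff_zero_smul A p x.1 0).trans ?_
      rw [← Algebra.smul_def]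
      rfl
    · refine (seriesCoeff_zero_smul A p x.1 1).trans ?_
      rw [← Algebra.smul_def]
      rfl
  · intro x hx
    refine hext x (fun i ↦ ?_) fun i ↦ ?_
    · rw [← hX, hx]; simp
    · rw [← hX, hx]; simp
  · intro x hx
    obtain ⟨h0, h1⟩ := (hε0 x).1 hx
    obtain ⟨-, hi⟩ := hrec x x.2
    -- Division by `T` is the shift of sequences: with zero constant coefficients, the equation at
    -- index 1 becomes the homogeneous one required at the start.
    obtain ⟨z, hz, hzc⟩ := hlift (fun i ↦ seriesCoeff A 0 (i + 1) x.1)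
      (fun i ↦ seriesCoeff A 1 (i + 1) x.1)
      (by
        have := hi 0
        rw [h0, h1] at this
        rw [mem_coupledKernel]
        simpa using this)
      (fun i ↦ hi (i + 1)) ((tendsto_seriesCoeff A 0 x.1).comp (tendsto_add_atTop_nat 1))
      ((tendsto_seriesCoeff A 1 x.1).comp (tendsto_add_atTop_nat 1))
    refine ⟨⟨z, hz⟩, sub_eq_zero.1 (hext _ (fun i ↦ ?_) fun i ↦ ?_)⟩
    · rw [Submodule.coe_sub, map_sub, sub_eq_zero]
      cases i with
      | zero => rw [hX0, h0]
      | succ i => rw [hX]; exact (hzc i).1.symm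
    · rw [Submodule.coe_sub, map_sub, sub_eq_zero]
      cases i with
      | zero => rw [hX0, h1]
      | succ i => rw [hX]; exact (hzc i).2.symm
  · rintro ⟨⟨x₀, y₀⟩, hp⟩
    obtain ⟨x, y, rfl, rfl, hx, hy, hi⟩ := exists_recursion_sequence (a := a₁₁) h₂₁ hb1 h x₀ y₀
    obtain ⟨z, hz, hzc⟩ := hlift x y hp hi hx hy
    exact ⟨⟨z, hz⟩, Subtype.ext (Prod.ext (hzc 0).1 (hzc 0).2)⟩
  · exact fun m n hmn x hx i hi l ↦ hx i (hmn.trans hi) l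
  · intro x
    have hev : ∀ l, ∀ᶠ i in atTop, ‖seriesCoeff A l i x.1‖ < δ := fun l ↦
      (tendsto_zero_iff_norm_tendsto_zero.1 (tendsto_seriesCoeff A l x.1)).eventually_lt_const hδ
    obtain ⟨n, hn⟩ := eventually_atTop.1 (eventually_all.2 hev)
    exact ⟨n, fun i hi l ↦ hn i hi l⟩
  -- When all coefficients are below `δ`, each pair in turn lies in the kernel, because the previous
  -- one is zero, and is too small to be nonzero.
  · refine (AddSubgroup.eq_bot_iff_forall _).2 fun x hx ↦ ?_
    obtain ⟨h0, hi⟩ := hrec x x.2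
    have hzero : ∀ i, (seriesCoeff A 0 i x.1, seriesCoeff A 1 i x.1) = 0 := fun i ↦ by
      induction i with
      | zero => exact hsmall _ h0 (hx 0 le_rfl 0) (hx 0 le_rfl 1)
      | succ i ih =>
        refine hsmall _ ?_ (hx (i + 1) (Nat.zero_le _) 0) (hx (i + 1) (Nat.zero_le _) 1)
        have := hi i
        rw [Prod.mk_eq_zero] at ih
        rw [ih.1, ih.2] at this
        rw [mem_coupledKernel]
        simpa using this
    exact hext x (fun i ↦ (Prod.ext_iff.1 (hzero i)).1) fun i ↦ (Prod.ext_iff.1 (hzero i)).2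
  · intro n x hx i hi l
    rw [← hX]
    exact hx (i + 1) (Nat.succ_le_succ hi) l
  · intro n c x hx
    obtain rfl | rfl : c = 0 ∨ c = 1 := by revert c; decide
    · rw [C_0, zero_smul]
      exact zero_mem _
    · rwa [C_1, one_smul]

/-- Since |x| = |θ|^(-ord x), the condition u > -2v - 2 is the required inequality written with
logarithms to the base |θ|; the case `a₁₂ = 0`, where u = +∞, is immediate. -/
theorem norm_lt_of_mem_D13 {v : ℝ} (hv : ord a₂₁ = (v : WithTop ℝ))
    (huv : (ord a₁₂, v) ∈ D13 2) :
    a₂₁ ≠ 0 ∧ ‖a₁₂‖ * ‖a₂₁‖ ^ 2 < ‖theta (ZMod 2) ^ 2‖ := by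
  have hθ := one_lt_norm_theta (ZMod 2)
  have h₂₁ : a₂₁ ≠ 0 := by
    rintro rfl
    simp [ord] at hv
  refine ⟨h₂₁, ?_⟩
  by_cases h₁₂ : a₁₂ = 0
  · rw [h₁₂, norm_zero, zero_mul, norm_pow]
    positivity
  have hv' : -Real.logb ‖theta (ZMod 2)‖ ‖a₂₁‖ = v := by
    rw [ord, if_neg h₂₁] at hv
    exact WithTop.coe_injective hv
  have hu : -2 * v - 2 < -Real.logb ‖theta (ZMod 2)‖ ‖a₁₂‖ := by
    have := huv.2
    simp only [ord, if_neg h₁₂, WithTop.coe_lt_coe] at this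
    exact_mod_cast this
  have p₁ : 0 < ‖a₁₂‖ := norm_pos_iff.2 h₁₂
  have p₂ : 0 < ‖a₂₁‖ := norm_pos_iff.2 h₂₁
  rw [norm_pow, ← Real.logb_lt_logb_iff hθ (by positivity) (by positivity),
    Real.logb_mul p₁.ne' (by positivity), Real.logb_pow, Real.logb_pow,
    Real.logb_self_eq_one hθ]
  push_cast
  linarith

end Cohomology

end AndersonMotive

end

theorem proposition7p1
    (a₁₁ a₁₂ a₂₁ : AndersonMotive.CInf (ZMod 2))
    (h₁₁ : AndersonMotive.ord a₁₁ = ((-1 : ℝ) : WithTop ℝ))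
    (v : ℝ) (hv : AndersonMotive.ord a₂₁ = (v : WithTop ℝ))
    (huv : (AndersonMotive.ord a₁₂, v) ∈ AndersonMotive.D13 2) :
    AndersonMotive.h1 (ZMod 2) (AndersonMotive.Motive !![a₁₁, a₁₂; a₂₁, 0]) = 4 := by
  obtain ⟨h₂₁, h⟩ := AndersonMotive.norm_lt_of_mem_D13 hv huv
  exact AndersonMotive.h1_eq_four_of_norm_lt h₂₁ h
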